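/- Let $N\ge 1$ be an integer, $R\in(0,1]$ and $\alpha\in\mathbb R$. Let $B_R\subset\mathbb R^N$ be the open ball of radius $R$ centred at $0$, let $\mathbb R^N_+$ be any open half-space whose boundary hyperplane contains $0$, i.e. $\mathbb R^N_+=\{x\in\mathbb R^N : \nu\cdot x>0\}$ for some unit vector $\nu$, and put $B_R^+=B_R\cap\mathbb R^N_+$ (so $B_R^+=(0,R)$ or $B_R^+=(-R,0)$ if $N=1$). Let $u\ge 0$ be a distributional solution of $$-\Delta u-\frac{N^2}{4}|x|^{-2}u\ \ge\ \alpha\,|x|^{-2}\bigl|\log|x|\bigr|^{-2}u\qquad\text{in }\mathcal D'(B_R^+),$$ that is, $u\in L^1_{\rm loc}(B_R^+)$, $u\ge 0$ almost everywhere in $B_R^+$, and $$-\int_{B_R^+}u\,\Delta\varphi\,dx-\frac{N^2}{4}\int_{B_R^+}|x|^{-2}u\,\varphi\,dx\ \ge\ \alpha\int_{B_R^+}|x|^{-2}\bigl|\log|x|\bigr|^{-2}u\,\varphi\,dx$$ for every non-negative $\varphi\in C_c^\infty(B_R^+)$. Assume that there exists $\gamma\le 1$ such that $$u\in L^2\bigl(B_R^+;\,|x|^{-2}\bigl|\log|x|\bigr|^{-2\gamma}dx\bigr)\qquad\text{and}\qquad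 \alpha\ge\frac14-(1-\gamma)^2 .$$ Then $u=0$ almost everywhere in $B_R^+$. -/

import Mathlib

open MeasureTheory Set
open scoped ContDiff

/-- The Euclidean space `ℝ^N`. -/
abbrev RN (N : ℕ) : Type := EuclideanSpace ℝ (Fin N)

/-- The open half-space `{x | ⟨ν, x⟩ > 0}` with inner normal `ν`; every open half-space with `0` on its
boundary is of this form for a unit vector `ν`. -/
def halfSpace {N : ℕ} (ν : RN N) : Set (RN N) :=
  {x | 0 < inner ℝ ν x}

/-- The half-ball `B_R⁺`, the intersection of the open ball `B_R` centred at `0` with a half-space. -/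
def halfBall {N : ℕ} (ν : RN N) (R : ℝ) : Set (RN N) :=
  Metric.ball 0 R ∩ halfSpace ν

/-- `φ` is a non-negative element of `C_c^∞(Ω)`. -/
structure IsNonnegTestFunction {N : ℕ} (Ω : Set (RN N)) (φ : RN N → ℝ) : Prop where
  smooth : ContDiff ℝ ∞ φ
  hasCompactSupport : HasCompactSupport φ
  tsupport_subset : tsupport φ ⊆ Ω
  nonneg : ∀ x, 0 ≤ φ x

/-- `u ∈ L¹_loc(Ω)` solves `-Δu - c |x|⁻² u ≥ α |x|⁻² |log |x||⁻² u` in the sense of distributions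
in the open set `Ω`. -/
structure IsDistributionalSolution {N : ℕ} (Ω : Set (RN N)) (c α : ℝ) (u : RN N → ℝ) : Prop where
  locallyIntegrableOn : LocallyIntegrableOn u Ω volume
  inequality : ∀ φ : RN N → ℝ, IsNonnegTestFunction Ω φ →
    α * ∫ x in Ω, (‖x‖ ^ 2)⁻¹ * (|Real.log ‖x‖| ^ 2)⁻¹ * u x * φ x
      ≤ -(∫ x in Ω, u x * Laplacian.laplacian φ x) - c * ∫ x in Ω, (‖x‖ ^ 2)⁻¹ * u x * φ x

/-- The measure `w(x) dx` on `Ω`, for a non-negative weight `w`. -/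
noncomputable def weightedMeasure {N : ℕ} (Ω : Set (RN N)) (w : RN N → ℝ) : Measure (RN N) :=
  (volume.restrict Ω).withDensity (fun x => ENNReal.ofReal (w x))

/-- The weight `|x|⁻² |log |x||^(-2γ)`. -/
noncomputable def hardyLerayWeight {N : ℕ} (γ : ℝ) (x : RN N) : ℝ :=
  (‖x‖ ^ 2)⁻¹ * |Real.log ‖x‖| ^ (-2 * γ)

/-!
Write `y = ⟨ν, x⟩`, `r = |x|`, `t = -log r`, `s = log t`, `δ = 1 - γ ≥ 0`.  Since `u ≥ 0`, the
constant `α` may be lowered to `1 / 4 - δ ^ 2` (`IsDistributionalSolution.mono`).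

The proof tests the inequality with explicit functions that detect `u` on a whole region, so neither
regularity of `u` nor a maximum principle is needed.

* The functions `y P(r²)` are admissible although they do not vanish near the flat part of the
  boundary (`integral_inner_mul_radial_nonpos`): replacing `y` by `h(y)` with `h` convex, vanishing
  near `0`, produces the extra term `h''(y) P(r²)` in the Laplacian, whose sign is favourable, and
  `h` can then tend to the identity because the weighted `L²` bound makes `u` integrable up to the
  flat boundary on every half-annulus.
* The factor `y r ^ (-N / 2)` absorbs the critical Hardy term of the half-space, and a further factor
  `t ^ (δ + 1 / 2)` absorbs the logarithmic one: on `y r ^ (-N / 2) t ^ (δ + 1 / 2) K(s)` the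
  operator acts, up to a positive factor, as `K'' + 2δK'` (`hardyLeray_logProfile`).
* The ramp `k` of `smoothRamp` vanishes for `s ≤ a` and satisfies `k'' + 2δk' > 0` for `s > a`, with
  `k = O(s)`, and `k` bounded when `δ > 0`.  Cutting it off between `s = n` and `s = 2n` costs an
  error `O(1 / n)` on that interval (`exists_compactly_supported_subsolution`).  The weight in the
  hypothesis on `u` is exactly dual to the measure `ds`, so by the Cauchy–Schwarz inequality the
  error contributes `O(1 / √n)`.  In the limit the integral of `u` against a function that is positive
  where `s > a` is nonpositive, so `u` vanishes there (`ae_eq_zero_of_lt_log`); and `a` may be any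
  number greater than `log (-log R)`, or any number at all if `R = 1`.
-/

open Filter Topology

/-! ### Smooth ramps -/

/-- The function vanishing for `s ≤ a` whose derivative is `exp (-2δs)` times a smooth increasing
step.  For `s > a` it is a strict subsolution of `k'' + 2δk' = 0`, and it grows as slowly as such a
subsolution can: linearly if `δ = 0`, while it stays bounded if `δ > 0`. -/
noncomputable def smoothRamp (δ a s : ℝ) : ℝ :=
  ∫ σ in a..s, Real.exp (-2 * δ * σ) * expNegInvGlue (σ - a)

/-- The derivative of `expNegInvGlue`. -/
noncomputable def expNegInvGlueDeriv (x : ℝ) : ℝ := (x⁻¹) ^ 2 * expNegInvGlue x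

theorem hasDerivAt_expNegInvGlue (x : ℝ) :
    HasDerivAt expNegInvGlue (expNegInvGlueDeriv x) x := by
  simpa [expNegInvGlueDeriv] using expNegInvGlue.hasDerivAt_polynomial_eval_inv_mul 1 x

theorem expNegInvGlueDeriv_nonneg (x : ℝ) : 0 ≤ expNegInvGlueDeriv x :=
  mul_nonneg (sq_nonneg _) (expNegInvGlue.nonneg x)

theorem expNegInvGlueDeriv_pos {x : ℝ} (hx : 0 < x) : 0 < expNegInvGlueDeriv x :=
  mul_pos (by positivity) (expNegInvGlue.pos_of_pos hx)

theorem expNegInvGlueDeriv_of_nonpos {x : ℝ} (hx : x ≤ 0) : expNegInvGlueDeriv x = 0 := by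
  simp [expNegInvGlueDeriv, expNegInvGlue.zero_of_nonpos hx]

theorem continuous_expNegInvGlue : Continuous expNegInvGlue :=
  (expNegInvGlue.contDiff (n := 0)).continuous

theorem continuous_expNegInvGlueDeriv : Continuous expNegInvGlueDeriv := by
  have h : deriv expNegInvGlue = expNegInvGlueDeriv :=
    funext fun x => (hasDerivAt_expNegInvGlue x).deriv
  rw [← h]
  exact (expNegInvGlue.contDiff (n := 1)).continuous_deriv le_rfl

theorem expNegInvGlue_le_one (x : ℝ) : expNegInvGlue x ≤ 1 := by
  unfold expNegInvGlue
  split_ifs with h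
  · exact zero_le_one
  · exact Real.exp_le_one_iff.2 (neg_nonpos.2 (inv_nonneg.2 (not_le.1 h).le))

theorem tendsto_expNegInvGlue_atTop : Tendsto expNegInvGlue atTop (𝓝 1) := by
  have h : Tendsto (fun x : ℝ => Real.exp (-x⁻¹)) atTop (𝓝 1) := by
    simpa [Function.comp_def] using
      (Real.continuous_exp.tendsto _).comp (tendsto_inv_atTop_zero (𝕜 := ℝ)).neg
  refine h.congr' ?_
  filter_upwards [eventually_gt_atTop 0] with x hx
  simp [expNegInvGlue, not_le.2 hx]

theorem continuous_smoothRamp_integrand (δ a : ℝ) :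
    Continuous fun σ : ℝ => Real.exp (-2 * δ * σ) * expNegInvGlue (σ - a) :=
  (by fun_prop : Continuous fun σ : ℝ => Real.exp (-2 * δ * σ)).mul
    (continuous_expNegInvGlue.comp (by fun_prop))

theorem hasDerivAt_smoothRamp (δ a s : ℝ) :
    HasDerivAt (smoothRamp δ a) (Real.exp (-2 * δ * s) * expNegInvGlue (s - a)) s :=
  intervalIntegral.integral_hasDerivAt_right
    ((continuous_smoothRamp_integrand δ a).intervalIntegrable _ _)
    (continuous_smoothRamp_integrand δ a).aestronglyMeasurable.stronglyMeasurableAtFilter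
    (continuous_smoothRamp_integrand δ a).continuousAt

theorem hasDerivAt_smoothRamp_deriv (δ a s : ℝ) :
    HasDerivAt (fun s => Real.exp (-2 * δ * s) * expNegInvGlue (s - a))
      (Real.exp (-2 * δ * s) * (expNegInvGlueDeriv (s - a) - 2 * δ * expNegInvGlue (s - a))) s := by
  have h1 : HasDerivAt (fun s : ℝ => Real.exp (-2 * δ * s)) (Real.exp (-2 * δ * s) * (-2 * δ)) s := by
    simpa using ((hasDerivAt_id s).const_mul (-2 * δ)).exp
  have h2 := (hasDerivAt_expNegInvGlue (s - a)).comp_sub_const s a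
  refine (h1.mul h2).congr_deriv ?_
  ring

theorem contDiff_smoothRamp (δ a : ℝ) : ContDiff ℝ ∞ (smoothRamp δ a) := by
  refine contDiff_infty_iff_deriv.2
    ⟨fun s => (hasDerivAt_smoothRamp δ a s).differentiableAt, ?_⟩
  have h : deriv (smoothRamp δ a) = fun s => Real.exp (-2 * δ * s) * expNegInvGlue (s - a) :=
    funext fun s => (hasDerivAt_smoothRamp δ a s).deriv
  rw [h]
  exact (Real.contDiff_exp.comp (contDiff_const.mul contDiff_id)).mul
    (expNegInvGlue.contDiff.comp (contDiff_id.sub contDiff_const))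

theorem smoothRamp_of_le {δ a s : ℝ} (h : s ≤ a) : smoothRamp δ a s = 0 := by
  unfold smoothRamp
  rw [intervalIntegral.integral_congr (g := fun _ => (0 : ℝ)), intervalIntegral.integral_zero]
  intro σ hσ
  rw [uIcc_of_ge h] at hσ
  simp [expNegInvGlue.zero_of_nonpos (sub_nonpos.2 hσ.2)]

theorem smoothRamp_nonneg (δ a s : ℝ) : 0 ≤ smoothRamp δ a s := by
  rcases le_total s a with h | h
  · exact (smoothRamp_of_le h).ge
  · exact intervalIntegral.integral_nonneg h fun σ _ =>
      mul_nonneg (Real.exp_pos _).le (expNegInvGlue.nonneg _)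

theorem smoothRamp_le {δ a s : ℝ} (hδ : 0 ≤ δ) (h : a ≤ s) :
    smoothRamp δ a s ≤ Real.exp (-2 * δ * a) * (s - a) := by
  have h1 : smoothRamp δ a s ≤ ∫ _ in a..s, Real.exp (-2 * δ * a) := by
    refine intervalIntegral.integral_mono_on h
      ((continuous_smoothRamp_integrand δ a).intervalIntegrable _ _) (by simp) fun σ hσ => ?_
    have h2 : Real.exp (-2 * δ * σ) ≤ Real.exp (-2 * δ * a) :=
      Real.exp_le_exp.2 (by nlinarith [hσ.1])
    calc _ ≤ Real.exp (-2 * δ * a) * 1 :=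
          mul_le_mul h2 (expNegInvGlue_le_one _) (expNegInvGlue.nonneg _) (Real.exp_pos _).le
      _ = _ := mul_one _
  refine h1.trans_eq ?_
  rw [intervalIntegral.integral_const, smul_eq_mul, mul_comm]

/-- Boundedness of the ramp for `δ > 0`; the linear bound `smoothRamp_le` would not suffice to
control the term `2δ K'` after truncation. -/
theorem two_mul_smoothRamp_le {δ : ℝ} (hδ : 0 ≤ δ) (a s : ℝ) :
    2 * δ * smoothRamp δ a s ≤ Real.exp (-2 * δ * a) := by
  rcases le_total s a with h | h
  · rw [smoothRamp_of_le h, mul_zero]; exact (Real.exp_pos _).le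
  have hd : ∀ σ ∈ uIcc a s, HasDerivAt (fun σ : ℝ => -Real.exp (-2 * δ * σ))
      (2 * δ * Real.exp (-2 * δ * σ)) σ := fun σ _ => by
    have := (((hasDerivAt_id σ).const_mul (-2 * δ)).exp).neg
    refine this.congr_deriv ?_
    simp; ring
  have hi : ∫ σ in a..s, 2 * δ * Real.exp (-2 * δ * σ) =
      -Real.exp (-2 * δ * s) - -Real.exp (-2 * δ * a) :=
    intervalIntegral.integral_eq_sub_of_hasDerivAt hd
      ((by fun_prop : Continuous fun σ : ℝ => 2 * δ * Real.exp (-2 * δ * σ)).intervalIntegrable _ _)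
  have h1 : 2 * δ * smoothRamp δ a s ≤ ∫ σ in a..s, 2 * δ * Real.exp (-2 * δ * σ) := by
    rw [smoothRamp, ← intervalIntegral.integral_const_mul]
    refine intervalIntegral.integral_mono_on h
      ((continuous_const.mul (continuous_smoothRamp_integrand δ a)).intervalIntegrable _ _)
      ((by fun_prop : Continuous fun σ : ℝ =>
        2 * δ * Real.exp (-2 * δ * σ)).intervalIntegrable _ _) fun σ _ => ?_
    refine mul_le_mul_of_nonneg_left ?_ (by positivity)
    exact mul_le_of_le_one_right (Real.exp_pos _).le (expNegInvGlue_le_one _)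
  rw [hi] at h1
  linarith [Real.exp_pos (-2 * δ * s)]

/-- Rescaling the ramp without damping approximates the identity on the half-line. -/
theorem tendsto_smoothRamp_div {y : ℝ} (hy : 0 < y) :
    Tendsto (fun n : ℕ => smoothRamp 0 1 ((n + 1) * y) / (n + 1)) atTop (𝓝 y) := by
  have hs : Tendsto (fun n : ℕ => ((n : ℝ) + 1) * y) atTop atTop :=
    (tendsto_atTop_add_const_right _ _ tendsto_natCast_atTop_atTop).atTop_mul_const hy
  have key : Tendsto (fun s : ℝ => smoothRamp 0 1 s / s) atTop (𝓝 1) := by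
    have hsq : Tendsto Real.sqrt atTop atTop := Real.tendsto_sqrt_atTop
    have hlow : Tendsto (fun s : ℝ => (1 - (Real.sqrt s)⁻¹) * expNegInvGlue (Real.sqrt s - 1))
        atTop (𝓝 1) := by
      have h1 : Tendsto (fun s : ℝ => 1 - (Real.sqrt s)⁻¹) atTop (𝓝 (1 - 0)) :=
        (tendsto_inv_atTop_zero.comp hsq).const_sub 1
      have h2 := tendsto_expNegInvGlue_atTop.comp (tendsto_atTop_add_const_right _ (-1) hsq)
      simpa [sub_eq_add_neg] using h1.mul h2
    refine tendsto_of_tendsto_of_tendsto_of_le_of_le' hlow tendsto_const_nhds ?_ ?_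
    · filter_upwards [eventually_ge_atTop 1] with s hs
      have h0 : 0 < s := by linarith
      have hm1 : 1 ≤ Real.sqrt s := Real.one_le_sqrt.2 hs
      have hm2 : Real.sqrt s * Real.sqrt s = s := Real.mul_self_sqrt h0.le
      have hms : Real.sqrt s ≤ s := by nlinarith
      -- the derivative is monotone, so on `[√s, s]` it is at least its value at `√s`
      have hint : ∀ p q : ℝ, IntervalIntegrable
          (fun σ : ℝ => Real.exp (-2 * 0 * σ) * expNegInvGlue (σ - 1)) volume p q :=
        fun p q => (continuous_smoothRamp_integrand 0 1).intervalIntegrable p q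
      have h1 : smoothRamp 0 1 s = smoothRamp 0 1 (Real.sqrt s) +
          ∫ σ in Real.sqrt s..s, Real.exp (-2 * 0 * σ) * expNegInvGlue (σ - 1) :=
        (intervalIntegral.integral_add_adjacent_intervals (hint _ _) (hint _ _)).symm
      have h2 : ∫ _ in Real.sqrt s..s, expNegInvGlue (Real.sqrt s - 1) ≤
          ∫ σ in Real.sqrt s..s, Real.exp (-2 * 0 * σ) * expNegInvGlue (σ - 1) := by
        refine intervalIntegral.integral_mono_on hms (by simp) (hint _ _) fun σ hσ => ?_
        simpa using expNegInvGlue.monotone (sub_le_sub_right hσ.1 1)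
      rw [intervalIntegral.integral_const, smul_eq_mul] at h2
      have h3 := smoothRamp_nonneg 0 1 (Real.sqrt s)
      rw [le_div_iff₀ h0]
      calc _ = (s - s * (Real.sqrt s)⁻¹) * expNegInvGlue (Real.sqrt s - 1) := by ring
        _ = (s - Real.sqrt s) * expNegInvGlue (Real.sqrt s - 1) := by
          congr 2
          rw [← div_eq_mul_inv, Real.div_sqrt]
        _ ≤ _ := by linarith
    · filter_upwards [eventually_ge_atTop 1] with s hs
      have := smoothRamp_le (δ := 0) le_rfl hs
      simp at this
      rw [div_le_one (by linarith)]
      linarith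
  have h := (key.comp hs).const_mul y
  rw [mul_one] at h
  refine h.congr fun n => ?_
  have : (n : ℝ) + 1 ≠ 0 := by positivity
  simp only [Function.comp_apply]
  field_simp

/-! ### The Laplacian of a product of a planar and a radial function -/

theorem hasFDerivAt_mul_inner_normSq {N : ℕ} (ν x : RN N) {f g : ℝ → ℝ} {f' g' : ℝ}
    (hf : HasDerivAt f f' (inner ℝ ν x)) (hg : HasDerivAt g g' (‖x‖ ^ 2)) :
    HasFDerivAt (fun z => f (inner ℝ ν z) * g (‖z‖ ^ 2))
      ((g (‖x‖ ^ 2) * f') • innerSL ℝ ν + (2 * f (inner ℝ ν x) * g') • innerSL ℝ x) x := by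
  have h1 : HasFDerivAt (fun z : RN N => f (inner ℝ ν z)) (f' • innerSL ℝ ν) x :=
    hf.comp_hasFDerivAt x (innerSL ℝ ν).hasFDerivAt
  have h2 := hg.comp_hasFDerivAt x (hasStrictFDerivAt_norm_sq x).hasFDerivAt
  refine (h1.mul h2).congr_fderiv ?_
  ext e
  simp
  ring

theorem laplacian_mul_inner_normSq {N : ℕ} {ν : RN N} (hν : ‖ν‖ = 1) {h h1 h2 P P1 P2 : ℝ → ℝ}
    (hh : ∀ y, HasDerivAt h (h1 y) y) (hh1 : ∀ y, HasDerivAt h1 (h2 y) y)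
    (hP : ∀ q, HasDerivAt P (P1 q) q) (hP1 : ∀ q, HasDerivAt P1 (P2 q) q)
    (hc : ContDiff ℝ 2 fun z : RN N => h (inner ℝ ν z) * P (‖z‖ ^ 2)) (x : RN N) :
    Laplacian.laplacian (fun z : RN N => h (inner ℝ ν z) * P (‖z‖ ^ 2)) x =
      h2 (inner ℝ ν x) * P (‖x‖ ^ 2) + 4 * inner ℝ ν x * h1 (inner ℝ ν x) * P1 (‖x‖ ^ 2) +
        h (inner ℝ ν x) * (4 * ‖x‖ ^ 2 * P2 (‖x‖ ^ 2) + 2 * N * P1 (‖x‖ ^ 2)) := by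
  set b := EuclideanSpace.basisFun (Fin N) ℝ
  rw [InnerProductSpace.laplacian_eq_iteratedFDeriv_orthonormalBasis _ b]
  set φ : RN N → ℝ := fun z : RN N => h (inner ℝ ν z) * P (‖z‖ ^ 2)
  have hterm : ∀ e : RN N, iteratedFDeriv ℝ 2 φ x ![e, e] =
      h2 (inner ℝ ν x) * P (‖x‖ ^ 2) * (inner ℝ ν e * inner ℝ e ν) +
      4 * h1 (inner ℝ ν x) * P1 (‖x‖ ^ 2) * (inner ℝ ν e * inner ℝ e x) +
      4 * h (inner ℝ ν x) * P2 (‖x‖ ^ 2) * (inner ℝ x e * inner ℝ e x) +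
      2 * h (inner ℝ ν x) * P1 (‖x‖ ^ 2) * (inner ℝ e e) := by
    intro e
    have hd : ∀ z, fderiv ℝ φ z e = (h1 (inner ℝ ν z) * P (‖z‖ ^ 2)) * inner ℝ ν e +
        2 * (h (inner ℝ ν z) * P1 (‖z‖ ^ 2)) * inner ℝ z e := by
      intro z
      rw [(hasFDerivAt_mul_inner_normSq ν z (hh _) (hP _)).fderiv]
      simp
      ring
    have hdiff : DifferentiableAt ℝ (fderiv ℝ φ) x :=
      (hc.fderiv_right (m := 1) (by norm_num)).differentiable (by norm_num) x
    have hs : fderiv ℝ (fderiv ℝ φ) x e e = fderiv ℝ (fun z => fderiv ℝ φ z e) x e := by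
      rw [fderiv_clm_apply hdiff (differentiableAt_const e)]
      simp
    have he : HasFDerivAt (fun z : RN N => inner ℝ z e) (innerSL ℝ e) x := by
      have : (fun z : RN N => inner ℝ z e) = fun z => innerSL ℝ e z := by
        funext z; simp [real_inner_comm]
      rw [this]
      exact (innerSL ℝ e).hasFDerivAt
    have h3 := ((hasFDerivAt_mul_inner_normSq ν x (hh1 _) (hP _)).mul_const (inner ℝ ν e)).add
      (((hasFDerivAt_mul_inner_normSq ν x (hh _) (hP1 _)).const_mul 2).mul he)
    rw [iteratedFDeriv_two_apply]
    simp only [Matrix.cons_val_zero, Matrix.cons_val_one]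
    rw [hs, funext hd]
    refine (congrArg (fun T => T e) h3.fderiv).trans ?_
    simp [real_inner_comm]
    ring
  simp only [hterm]
  rw [Finset.sum_add_distrib, Finset.sum_add_distrib, Finset.sum_add_distrib,
    ← Finset.mul_sum, ← Finset.mul_sum, ← Finset.mul_sum, ← Finset.mul_sum,
    b.sum_inner_mul_inner, b.sum_inner_mul_inner, b.sum_inner_mul_inner]
  have h4 : ∑ i, inner ℝ (b i) (b i) = (N : ℝ) := by simp
  rw [h4, real_inner_self_eq_norm_sq, real_inner_self_eq_norm_sq, hν]
  ring

/-! ### Integrability on half-annuli -/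

theorem isOpen_halfBall {N : ℕ} (ν : RN N) (R : ℝ) : IsOpen (halfBall ν R) :=
  Metric.isOpen_ball.inter (isOpen_lt continuous_const (by fun_prop))

theorem inner_pos_of_mem_halfBall {N : ℕ} {ν : RN N} {R : ℝ} {x : RN N} (hx : x ∈ halfBall ν R) :
    0 < inner ℝ ν x := hx.2

theorem norm_lt_of_mem_halfBall {N : ℕ} {ν : RN N} {R : ℝ} {x : RN N} (hx : x ∈ halfBall ν R) :
    ‖x‖ < R := by simpa using hx.1

theorem norm_pos_of_mem_halfBall {N : ℕ} {ν : RN N} {R : ℝ} {x : RN N} (hx : x ∈ halfBall ν R) :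
    0 < ‖x‖ := by
  refine norm_pos_iff.2 fun h => ?_
  have := inner_pos_of_mem_halfBall hx
  simp [h] at this

theorem inner_le_norm_of_norm_eq_one {N : ℕ} {ν : RN N} (hν : ‖ν‖ = 1) (x : RN N) :
    inner ℝ ν x ≤ ‖x‖ := by
  simpa [hν] using real_inner_le_norm ν x

theorem measurable_hardyLerayWeight {N : ℕ} (γ : ℝ) :
    Measurable (hardyLerayWeight γ : RN N → ℝ) := by
  unfold hardyLerayWeight
  have h : Measurable fun x : RN N => |Real.log ‖x‖| :=
    continuous_abs.measurable.comp (Real.measurable_log.comp measurable_norm)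
  exact (measurable_norm.pow_const 2).inv.mul (h.pow_const _)

theorem hardyLerayWeight_nonneg {N : ℕ} (γ : ℝ) (x : RN N) : 0 ≤ hardyLerayWeight γ x := by
  unfold hardyLerayWeight; positivity

theorem integrable_sq_mul_hardyLerayWeight {N : ℕ} {Ω : Set (RN N)} {γ : ℝ} {u : RN N → ℝ}
    (hu : MemLp u 2 (weightedMeasure Ω (hardyLerayWeight γ))) :
    Integrable (fun x => u x ^ 2 * hardyLerayWeight γ x) (volume.restrict Ω) := by
  have h := hu.integrable_sq
  unfold weightedMeasure at h
  rw [integrable_withDensity_iff (measurable_hardyLerayWeight γ).ennreal_ofReal (by simp)] at h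
  simpa [ENNReal.toReal_ofReal (hardyLerayWeight_nonneg γ _)] using h

/-- A function in the weighted `L²` space is integrable on half-annuli, up to the flat part of the
boundary, where the weight is bounded from below. -/
theorem integrable_mul_radial {N : ℕ} {ν : RN N} {R γ : ℝ} {u : RN N → ℝ} (hR : R ≤ 1)
    (hum : AEStronglyMeasurable u (volume.restrict (halfBall ν R)))
    (hu : Integrable (fun x => u x ^ 2 * hardyLerayWeight γ x) (volume.restrict (halfBall ν R)))
    {r₁ r₂ B : ℝ} (hr₁ : 0 < r₁) (hr₂ : r₂ < R) {b : RN N → ℝ} (hb : Measurable b)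
    (hbB : ∀ x ∈ halfBall ν R, |b x| ≤ B) {F : ℝ → ℝ} (hF : Measurable F)
    (hFc : ContinuousOn F (Icc r₁ r₂)) (hF0 : ∀ r ∈ Ioo 0 R, r ∉ Icc r₁ r₂ → F r = 0) :
    Integrable (fun x => u x * (b x * F ‖x‖)) (volume.restrict (halfBall ν R)) := by
  obtain ⟨C, hC⟩ := isCompact_Icc.exists_bound_of_continuousOn hFc
  have hwc : ContinuousOn (fun r : ℝ => ((r ^ 2)⁻¹ * |Real.log r| ^ (-2 * γ))⁻¹) (Icc r₁ r₂) := by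
    have hlog : ∀ r ∈ Icc r₁ r₂, |Real.log r| ≠ 0 := fun r hr =>
      abs_ne_zero.2 (Real.log_neg (hr₁.trans_le hr.1) (by linarith [hr.2])).ne
    have h0 : ∀ r ∈ Icc r₁ r₂, r ≠ 0 := fun r hr => (hr₁.trans_le hr.1).ne'
    refine ContinuousOn.inv₀ (((continuousOn_id.pow 2).inv₀ fun r hr => pow_ne_zero 2 (h0 r hr)).mul
      ((continuousOn_id.log h0).abs.rpow_const fun r hr => Or.inl (hlog r hr))) fun r hr => ?_
    have h1 : 0 < |Real.log r| := lt_of_le_of_ne (abs_nonneg _) (hlog r hr).symm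
    have h2 : 0 < r := hr₁.trans_le hr.1
    have h3 : 0 < ((fun x : ℝ => x) r ^ 2)⁻¹ * |Real.log r| ^ (-2 * γ) := by positivity
    exact h3.ne'
  obtain ⟨M, hM⟩ := isCompact_Icc.exists_bound_of_continuousOn hwc
  have hfin : volume (halfBall ν R) < ⊤ :=
    (measure_mono inter_subset_left).trans_lt measure_ball_lt_top
  have : IsFiniteMeasure (volume.restrict (halfBall ν R)) := ⟨by simpa using hfin⟩
  refine ((hu.add (integrable_const |M|)).const_mul (|B| * |C|)).mono'
    (hum.mul (hb.mul (hF.comp measurable_norm)).aestronglyMeasurable) ?_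
  filter_upwards [ae_restrict_mem (isOpen_halfBall ν R).measurableSet] with x hx
  simp only [Pi.add_apply]
  by_cases hr : ‖x‖ ∈ Icc r₁ r₂
  · have h1 := hC _ hr
    have h2 := hM _ hr
    have hw : 0 < hardyLerayWeight γ x := by
      have h3 : Real.log ‖x‖ ≠ 0 :=
        (Real.log_neg (norm_pos_of_mem_halfBall hx) (by linarith [hr.2])).ne
      have := norm_pos_of_mem_halfBall hx
      unfold hardyLerayWeight
      positivity
    change ‖(hardyLerayWeight γ x)⁻¹‖ ≤ M at h2
    rw [Real.norm_of_nonneg (by positivity)] at h2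
    have h4 : |u x| ≤ u x ^ 2 * hardyLerayWeight γ x + (hardyLerayWeight γ x)⁻¹ := by
      have h5 : 0 ≤ (|u x| * hardyLerayWeight γ x - 1) ^ 2 * (hardyLerayWeight γ x)⁻¹ := by
        positivity
      have h6 : (|u x| * hardyLerayWeight γ x - 1) ^ 2 * (hardyLerayWeight γ x)⁻¹ =
          u x ^ 2 * hardyLerayWeight γ x - 2 * |u x| + (hardyLerayWeight γ x)⁻¹ := by
        rw [← sq_abs (u x)]; field_simp; ring
      linarith [abs_nonneg (u x)]
    rw [Real.norm_eq_abs] at h1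
    rw [Real.norm_eq_abs, abs_mul, abs_mul, mul_comm]
    have hB := (hbB x hx).trans (le_abs_self B)
    have hC' := h1.trans (le_abs_self C)
    gcongr
    linarith [le_abs_self M]
  · rw [hF0 _ ⟨norm_pos_of_mem_halfBall hx, norm_lt_of_mem_halfBall hx⟩ hr]
    have := hardyLerayWeight_nonneg γ x
    simp only [mul_zero, norm_zero]
    positivity

/-! ### Test functions that do not vanish at the flat boundary -/

theorem deriv_eq_zero_of_notMem {f : ℝ → ℝ} {K : Set ℝ} (hK : IsClosed K)
    (hf : ∀ r, r ∉ K → f r = 0) {r : ℝ} (hr : r ∉ K) : deriv f r = 0 := by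
  have h : f =ᶠ[𝓝 r] fun _ => 0 := by
    filter_upwards [hK.isOpen_compl.mem_nhds hr] with s hs using hf s hs
  rw [h.deriv_eq, deriv_const]

/-- A nonnegative distributional solution may be tested against `⟨ν, x⟩ P(|x|²)`, although this
function does not have compact support in the half-ball.  It is approximated by
`h(⟨ν, x⟩) P(|x|²)` with `h` convex, and the term containing `h''` has a favourable sign. -/
theorem integral_inner_mul_radial_nonpos {N : ℕ} {ν : RN N} (hν : ‖ν‖ = 1) {R α c γ : ℝ}
    {u : RN N → ℝ} (hR : R ≤ 1)
    (hu0 : ∀ᵐ x ∂(volume.restrict (halfBall ν R)), 0 ≤ u x)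
    (hsol : IsDistributionalSolution (halfBall ν R) c α u)
    (hu : Integrable (fun x => u x ^ 2 * hardyLerayWeight γ x) (volume.restrict (halfBall ν R)))
    {r₁ r₂ : ℝ} (hr₁ : 0 < r₁) (hr₁₂ : r₁ ≤ r₂) (hr₂ : r₂ < R) {P : ℝ → ℝ} (hP : ContDiff ℝ ∞ P)
    (hPnn : ∀ q, 0 ≤ P q) (hP0 : ∀ q, q ∉ Icc (r₁ ^ 2) (r₂ ^ 2) → P q = 0) :
    ∫ x in halfBall ν R, u x * (inner ℝ ν x * (4 * ‖x‖ ^ 2 * deriv (deriv P) (‖x‖ ^ 2) +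
      (2 * N + 4) * deriv P (‖x‖ ^ 2) + c * ((‖x‖ ^ 2)⁻¹ * P (‖x‖ ^ 2)) +
      α * ((‖x‖ ^ 2)⁻¹ * (|Real.log ‖x‖| ^ 2)⁻¹ * P (‖x‖ ^ 2)))) ≤ 0 := by
  set Ω := halfBall ν R with hΩ
  set P1 := deriv P with hP1
  set P2 := deriv P1 with hP2
  have hum : AEStronglyMeasurable u (volume.restrict Ω) :=
    hsol.locallyIntegrableOn.aestronglyMeasurable
  have hmΩ : ∀ᵐ x ∂(volume.restrict Ω), x ∈ Ω :=
    ae_restrict_mem (isOpen_halfBall ν R).measurableSet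
  have hcP : Continuous P := hP.continuous
  have hP1s : ContDiff ℝ ∞ P1 := (contDiff_infty_iff_deriv.1 hP).2
  have hP2s : ContDiff ℝ ∞ P2 := (contDiff_infty_iff_deriv.1 hP1s).2
  have hdP : ∀ q, HasDerivAt P (P1 q) q := fun q => (hP.differentiable (by simp) q).hasDerivAt
  have hdP1 : ∀ q, HasDerivAt P1 (P2 q) q := fun q => (hP1s.differentiable (by simp) q).hasDerivAt
  have hP10 : ∀ q, q ∉ Icc (r₁ ^ 2) (r₂ ^ 2) → P1 q = 0 := fun q hq =>
    deriv_eq_zero_of_notMem isClosed_Icc hP0 hq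
  have hP20 : ∀ q, q ∉ Icc (r₁ ^ 2) (r₂ ^ 2) → P2 q = 0 := fun q hq =>
    deriv_eq_zero_of_notMem isClosed_Icc hP10 hq
  have hsq : ∀ r : ℝ, 0 ≤ r → r ∉ Icc r₁ r₂ → r ^ 2 ∉ Icc (r₁ ^ 2) (r₂ ^ 2) := fun r hr hx h =>
    hx ⟨(pow_le_pow_iff_left₀ hr₁.le hr two_ne_zero).1 h.1,
      (pow_le_pow_iff_left₀ hr (hr₁.le.trans hr₁₂) two_ne_zero).1 h.2⟩
  -- products of `u`, a bounded function and one of the radial factors are integrable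
  have hne : ∀ r ∈ Icc r₁ r₂, r ≠ 0 := fun r hr => (hr₁.trans_le hr.1).ne'
  have hinv : ContinuousOn (fun r : ℝ => (r ^ 2)⁻¹) (Icc r₁ r₂) :=
    (continuousOn_id.pow 2).inv₀ fun r hr => pow_ne_zero 2 (hne r hr)
  have hlog : ContinuousOn (fun r : ℝ => (|Real.log r| ^ 2)⁻¹) (Icc r₁ r₂) :=
    ((continuousOn_id.log hne).abs.pow 2).inv₀ fun r hr => pow_ne_zero 2
      (abs_ne_zero.2 (Real.log_neg (hr₁.trans_le hr.1) (by linarith [hr.2])).ne)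
  have hlogm : Measurable fun r : ℝ => (|Real.log r| ^ 2)⁻¹ :=
    ((continuous_abs.measurable.comp Real.measurable_log).pow_const 2).inv
  have hinvm : Measurable fun r : ℝ => (r ^ 2)⁻¹ := (measurable_id.pow_const 2).inv
  have hPc : Continuous fun r : ℝ => P (r ^ 2) := hcP.comp (by fun_prop)
  have hP1c : Continuous fun r : ℝ => P1 (r ^ 2) := hP1s.continuous.comp (by fun_prop)
  have hP2c : Continuous fun r : ℝ => P2 (r ^ 2) := hP2s.continuous.comp (by fun_prop)
  have hint : ∀ (b : RN N → ℝ) (B : ℝ) (F : ℝ → ℝ), Measurable b → (∀ x ∈ Ω, |b x| ≤ B) →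
      Measurable F → ContinuousOn F (Icc r₁ r₂) → (∀ r ∈ Ioo 0 R, r ∉ Icc r₁ r₂ → F r = 0) →
      Integrable (fun x => u x * (b x * F ‖x‖)) (volume.restrict Ω) :=
    fun b B F hb hB hF hFc hF0 => integrable_mul_radial hR hum hu hr₁ hr₂ hb hB hF hFc hF0
  have hint0 : ∀ b : RN N → ℝ, ∀ B, Measurable b → (∀ x ∈ Ω, |b x| ≤ B) →
      Integrable (fun x => u x * (b x * P (‖x‖ ^ 2))) (volume.restrict Ω) := fun b B hb hB =>
    hint b B _ hb hB hPc.measurable hPc.continuousOn fun r h0 hr => hP0 _ (hsq r h0.1.le hr)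
  have hint1 : ∀ b : RN N → ℝ, ∀ B, Measurable b → (∀ x ∈ Ω, |b x| ≤ B) →
      Integrable (fun x => u x * (b x * P1 (‖x‖ ^ 2))) (volume.restrict Ω) := fun b B hb hB =>
    hint b B _ hb hB hP1c.measurable hP1c.continuousOn fun r h0 hr => hP10 _ (hsq r h0.1.le hr)
  have hint2 : ∀ b : RN N → ℝ, ∀ B, Measurable b → (∀ x ∈ Ω, |b x| ≤ B) →
      Integrable (fun x => u x * (b x * (4 * ‖x‖ ^ 2 * P2 (‖x‖ ^ 2) + 2 * N * P1 (‖x‖ ^ 2))))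
        (volume.restrict Ω) := fun b B hb hB => by
    have hc : Continuous fun r : ℝ => 4 * r ^ 2 * P2 (r ^ 2) + 2 * N * P1 (r ^ 2) :=
      ((by fun_prop : Continuous fun r : ℝ => 4 * r ^ 2).mul hP2c).add (hP1c.const_mul _)
    refine hint b B _ hb hB hc.measurable hc.continuousOn fun r h0 hr => ?_
    simp only [hP10 _ (hsq r h0.1.le hr), hP20 _ (hsq r h0.1.le hr), mul_zero, add_zero]
  have hint3 : ∀ b : RN N → ℝ, ∀ B, Measurable b → (∀ x ∈ Ω, |b x| ≤ B) →
      Integrable (fun x => u x * (b x * ((‖x‖ ^ 2)⁻¹ * P (‖x‖ ^ 2))))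
        (volume.restrict Ω) := fun b B hb hB => by
    refine hint b B (fun r => (r ^ 2)⁻¹ * P (r ^ 2)) hb hB (hinvm.mul hPc.measurable)
      (hinv.mul hPc.continuousOn) fun r h0 hr => ?_
    simp only [hP0 _ (hsq r h0.1.le hr), mul_zero]
  have hint4 : ∀ b : RN N → ℝ, ∀ B, Measurable b → (∀ x ∈ Ω, |b x| ≤ B) →
      Integrable (fun x => u x * (b x * ((‖x‖ ^ 2)⁻¹ * (|Real.log ‖x‖| ^ 2)⁻¹ * P (‖x‖ ^ 2))))
        (volume.restrict Ω) := fun b B hb hB => by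
    refine hint b B (fun r => (r ^ 2)⁻¹ * (|Real.log r| ^ 2)⁻¹ * P (r ^ 2)) hb hB
      ((hinvm.mul hlogm).mul hPc.measurable) ((hinv.mul hlog).mul hPc.continuousOn) fun r h0 hr => ?_
    simp only [hP0 _ (hsq r h0.1.le hr), mul_zero]
  have hym : Measurable fun x : RN N => inner ℝ ν x :=
    (by fun_prop : Continuous fun x : RN N => inner ℝ ν x).measurable
  have hy1 : ∀ x ∈ Ω, inner ℝ ν x ≤ 1 := fun x hx =>
    (inner_le_norm_of_norm_eq_one hν x).trans ((norm_lt_of_mem_halfBall hx).le.trans hR)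
  have hyabs : ∀ x ∈ Ω, |inner ℝ ν x| ≤ 1 := fun x hx => by
    rw [abs_of_pos (inner_pos_of_mem_halfBall hx)]; exact hy1 x hx
  set W : RN N → ℝ := fun x => 4 * ‖x‖ ^ 2 * P2 (‖x‖ ^ 2) + 2 * N * P1 (‖x‖ ^ 2) +
    c * ((‖x‖ ^ 2)⁻¹ * P (‖x‖ ^ 2)) +
      α * ((‖x‖ ^ 2)⁻¹ * (|Real.log ‖x‖| ^ 2)⁻¹ * P (‖x‖ ^ 2)) with hW
  have hintW : ∀ b : RN N → ℝ, ∀ B, Measurable b → (∀ x ∈ Ω, |b x| ≤ B) →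
      Integrable (fun x => u x * (b x * W x)) (volume.restrict Ω) := fun b B hb hB => by
    refine (((hint2 b B hb hB).add ((hint3 b B hb hB).const_mul c)).add
      ((hint4 b B hb hB).const_mul α)).congr (ae_of_all _ fun x => ?_)
    simp only [Pi.add_apply, hW]
    ring
  -- convex approximations of the identity on the half-line, vanishing near zero
  set h : ℕ → ℝ → ℝ := fun n y => smoothRamp 0 1 ((n + 1) * y) / (n + 1) with hh
  set h1 : ℕ → ℝ → ℝ := fun n y => expNegInvGlue ((n + 1) * y - 1) with hh1
  set h2 : ℕ → ℝ → ℝ := fun n y => (n + 1) * expNegInvGlueDeriv ((n + 1) * y - 1) with hh2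
  have hn0 : ∀ n : ℕ, (n : ℝ) + 1 ≠ 0 := fun n => by positivity
  have hnp : ∀ n : ℕ, 0 < (n : ℝ) + 1 := fun n => by positivity
  have hlin : ∀ (n : ℕ) (y : ℝ), HasDerivAt (fun y : ℝ => ((n : ℝ) + 1) * y) (n + 1) y :=
    fun n y => by simpa using (hasDerivAt_id y).const_mul ((n : ℝ) + 1)
  have hdh : ∀ n y, HasDerivAt (h n) (h1 n y) y := fun n y => by
    have := ((hasDerivAt_smoothRamp 0 1 (((n : ℝ) + 1) * y)).comp y (hlin n y)).div_const (n + 1)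
    refine this.congr_deriv ?_
    simp [hh1, hn0]
  have hdh1 : ∀ n y, HasDerivAt (h1 n) (h2 n y) y := fun n y => by
    have := (hasDerivAt_expNegInvGlue (((n : ℝ) + 1) * y - 1)).comp y ((hlin n y).sub_const 1)
    exact this.congr_deriv (mul_comm _ _)
  have hhs : ∀ n, ContDiff ℝ ∞ (h n) := fun n =>
    ((contDiff_smoothRamp 0 1).comp (contDiff_const.mul contDiff_id)).div_const _
  have hh_nonneg : ∀ n y, 0 ≤ h n y := fun n y => div_nonneg (smoothRamp_nonneg _ _ _) (hnp n).le
  have hh_zero : ∀ (n : ℕ) (y : ℝ), y ≤ 1 / ((n : ℝ) + 1) → h n y = 0 := fun n y hy => by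
    have : ((n : ℝ) + 1) * y ≤ 1 := by rwa [le_div_iff₀ (hnp n), mul_comm] at hy
    simp [hh, smoothRamp_of_le this]
  have hh_le : ∀ n y, 0 < y → h n y ≤ y := fun n y hy => by
    rcases le_total y (1 / ((n : ℝ) + 1)) with h | h
    · rw [hh_zero n y h]; exact hy.le
    · rw [div_le_iff₀ (hnp n), mul_comm] at h
      have := smoothRamp_le (δ := 0) le_rfl h
      simp only [mul_zero, zero_mul, Real.exp_zero, one_mul] at this
      rw [hh]
      simp only
      rw [div_le_iff₀ (hnp n)]
      linarith
  have hh1_abs : ∀ n y, |h1 n y| ≤ 1 := fun n y => by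
    rw [abs_of_nonneg (expNegInvGlue.nonneg _)]; exact expNegInvGlue_le_one _
  have hhm : ∀ n, Measurable fun x : RN N => h n (inner ℝ ν x) := fun n =>
    (hhs n).continuous.measurable.comp hym
  have hh1m : ∀ n, Measurable fun x : RN N => h1 n (inner ℝ ν x) := fun n =>
    (continuous_expNegInvGlue.comp (by fun_prop)).measurable
  have hh2c : ∀ n, Continuous (h2 n) := fun n =>
    (continuous_expNegInvGlueDeriv.comp (by fun_prop)).const_mul _
  have hh_abs : ∀ n, ∀ x ∈ Ω, |h n (inner ℝ ν x)| ≤ 1 := fun n x hx => by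
    rw [abs_of_nonneg (hh_nonneg _ _)]
    exact (hh_le n _ (inner_pos_of_mem_halfBall hx)).trans (hy1 x hx)
  -- the test functions
  have htest : ∀ n, IsNonnegTestFunction Ω
      (fun x : RN N => h n (inner ℝ ν x) * P (‖x‖ ^ 2)) := by
    intro n
    have hts : tsupport (fun x : RN N => h n (inner ℝ ν x) * P (‖x‖ ^ 2)) ⊆
        {x : RN N | 1 / ((n : ℝ) + 1) ≤ inner ℝ ν x} ∩ Metric.closedBall 0 r₂ := by
      refine closure_minimal (fun x hx => ?_)
        ((isClosed_le continuous_const (by fun_prop)).inter Metric.isClosed_closedBall)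
      rw [Function.mem_support] at hx
      refine ⟨?_, ?_⟩
      · by_contra hlt
        exact hx (by simp [hh_zero n _ (not_le.1 hlt).le])
      · by_contra hgt
        refine hx ?_
        rw [hP0 _ (hsq _ (norm_nonneg x) fun hr => hgt (by simpa using hr.2)), mul_zero]
    refine ⟨?_, ?_, ?_, fun x => mul_nonneg (hh_nonneg _ _) (hPnn _)⟩
    · exact ((hhs n).comp (contDiff_const.inner ℝ contDiff_id)).mul
        (hP.comp (contDiff_id.norm_sq ℝ))
    · exact (isCompact_closedBall (0 : RN N) r₂).of_isClosed_subset (isClosed_tsupport _)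
        (hts.trans inter_subset_right)
    · intro x hx
      obtain ⟨hx1, hx2⟩ := hts hx
      refine ⟨?_, lt_of_lt_of_le (one_div_pos.2 (hnp n)) hx1⟩
      rw [mem_ball_zero_iff]
      exact (mem_closedBall_zero_iff.1 hx2).trans_lt hr₂
  -- testing with the approximations and dropping the favourable term
  have hstep : ∀ n, ∫ x in Ω, (u x * (4 * inner ℝ ν x * h1 n (inner ℝ ν x) * P1 (‖x‖ ^ 2)) +
      u x * (h n (inner ℝ ν x) * W x)) ≤ 0 := by
    intro n
    have hineq := hsol.inequality _ (htest n)
    obtain ⟨D, hD⟩ := (isCompact_Icc (a := (-1 : ℝ)) (b := 1)).exists_bound_of_continuousOn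
      (hh2c n).continuousOn
    have i0 := hint0 (fun x => h2 n (inner ℝ ν x)) D ((hh2c n).measurable.comp hym)
      fun x hx => hD _ (abs_le.1 (hyabs x hx))
    have i1 := hint1 (fun x => 4 * inner ℝ ν x * h1 n (inner ℝ ν x)) 4
      ((hym.const_mul 4).mul (hh1m n)) fun x hx => by
        rw [abs_mul, abs_mul, abs_of_pos (by norm_num : (0 : ℝ) < 4)]
        nlinarith [hh1_abs n (inner ℝ ν x), hyabs x hx, abs_nonneg (inner ℝ ν x),
          abs_nonneg (h1 n (inner ℝ ν x))]
    have i2 := hint2 _ 1 (hhm n) (hh_abs n)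
    have i3 := hint3 _ 1 (hhm n) (hh_abs n)
    have i4 := hint4 _ 1 (hhm n) (hh_abs n)
    have iW := hintW _ 1 (hhm n) (hh_abs n)
    have hc : ContDiff ℝ 2 fun z : RN N => h n (inner ℝ ν z) * P (‖z‖ ^ 2) :=
      (htest n).smooth.of_le (WithTop.coe_le_coe.2 le_top)
    have e1 : ∫ x in Ω, u x *
        Laplacian.laplacian (fun z : RN N => h n (inner ℝ ν z) * P (‖z‖ ^ 2)) x =
        (∫ x in Ω, u x * (h2 n (inner ℝ ν x) * P (‖x‖ ^ 2))) +
        ((∫ x in Ω, u x * (4 * inner ℝ ν x * h1 n (inner ℝ ν x) * P1 (‖x‖ ^ 2))) +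
        ∫ x in Ω, u x * (h n (inner ℝ ν x) *
          (4 * ‖x‖ ^ 2 * P2 (‖x‖ ^ 2) + 2 * N * P1 (‖x‖ ^ 2)))) := by
      rw [← integral_add' i1 i2, ← integral_add' i0 (i1.add i2)]
      refine integral_congr_ae (ae_of_all _ fun x => ?_)
      simp only [laplacian_mul_inner_normSq hν (hdh n) (hdh1 n) hdP hdP1 hc x, Pi.add_apply]
      ring
    have e3 : ∫ x in Ω, (‖x‖ ^ 2)⁻¹ * u x * (h n (inner ℝ ν x) * P (‖x‖ ^ 2)) =
        ∫ x in Ω, u x * (h n (inner ℝ ν x) * ((‖x‖ ^ 2)⁻¹ * P (‖x‖ ^ 2))) :=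
      integral_congr_ae (ae_of_all _ fun x => by ring)
    have e4 : ∫ x in Ω, (‖x‖ ^ 2)⁻¹ * (|Real.log ‖x‖| ^ 2)⁻¹ * u x *
        (h n (inner ℝ ν x) * P (‖x‖ ^ 2)) = ∫ x in Ω, u x * (h n (inner ℝ ν x) *
          ((‖x‖ ^ 2)⁻¹ * (|Real.log ‖x‖| ^ 2)⁻¹ * P (‖x‖ ^ 2))) :=
      integral_congr_ae (ae_of_all _ fun x => by ring)
    rw [e1, e3, e4] at hineq
    have eW : ∫ x in Ω, u x * (h n (inner ℝ ν x) * W x) =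
        (∫ x in Ω, u x * (h n (inner ℝ ν x) *
          (4 * ‖x‖ ^ 2 * P2 (‖x‖ ^ 2) + 2 * N * P1 (‖x‖ ^ 2)))) +
        c * (∫ x in Ω, u x * (h n (inner ℝ ν x) * ((‖x‖ ^ 2)⁻¹ * P (‖x‖ ^ 2)))) +
        α * ∫ x in Ω, u x * (h n (inner ℝ ν x) *
          ((‖x‖ ^ 2)⁻¹ * (|Real.log ‖x‖| ^ 2)⁻¹ * P (‖x‖ ^ 2))) := by
      rw [← integral_const_mul, ← integral_const_mul, ← integral_add' i2 (i3.const_mul c),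
        ← integral_add' (i2.add (i3.const_mul c)) (i4.const_mul α)]
      refine integral_congr_ae (ae_of_all _ fun x => ?_)
      simp only [Pi.add_apply, hW]
      ring
    have hpos : 0 ≤ ∫ x in Ω, u x * (h2 n (inner ℝ ν x) * P (‖x‖ ^ 2)) := by
      refine integral_nonneg_of_ae ?_
      filter_upwards [hu0] with x hx
      exact mul_nonneg hx (mul_nonneg
        (mul_nonneg (hnp n).le (expNegInvGlueDeriv_nonneg _)) (hPnn _))
    rw [integral_add i1 iW, eW]
    linarith
  -- passage to the limit
  have j1 := (hint1 (fun x => inner ℝ ν x) 1 hym hyabs).norm.const_mul 4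
  have jW := (hintW (fun x => inner ℝ ν x) 1 hym hyabs).norm
  have hlim := tendsto_integral_of_dominated_convergence (μ := volume.restrict Ω)
    (F := fun (n : ℕ) x => u x * (4 * inner ℝ ν x * h1 n (inner ℝ ν x) * P1 (‖x‖ ^ 2)) +
      u x * (h n (inner ℝ ν x) * W x))
    (f := fun x => u x * (4 * inner ℝ ν x * 1 * P1 (‖x‖ ^ 2)) + u x * (inner ℝ ν x * W x))
    _ ?_ (j1.add jW) ?_ ?_
  · refine (integral_congr_ae (ae_of_all _ fun x => ?_)).trans_le
      (le_of_tendsto' hlim hstep)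
    simp only [hW]
    ring
  · intro n
    refine ((hint1 (fun x => 4 * inner ℝ ν x * h1 n (inner ℝ ν x)) 4
      ((hym.const_mul 4).mul (hh1m n)) fun x hx => ?_).add
        (hintW _ 1 (hhm n) (hh_abs n))).aestronglyMeasurable
    rw [abs_mul, abs_mul, abs_of_pos (by norm_num : (0 : ℝ) < 4)]
    nlinarith [hh1_abs n (inner ℝ ν x), hyabs x hx, abs_nonneg (inner ℝ ν x),
      abs_nonneg (h1 n (inner ℝ ν x))]
  · intro n
    filter_upwards [hmΩ] with x hx
    have hy := inner_pos_of_mem_halfBall hx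
    refine (norm_add_le _ _).trans (add_le_add ?_ ?_)
    · simp only [norm_mul, Real.norm_eq_abs, abs_of_pos (by norm_num : (0 : ℝ) < 4)]
      have := hh1_abs n (inner ℝ ν x)
      calc _ = 4 * (|u x| * (|inner ℝ ν x| * |P1 (‖x‖ ^ 2)|)) * |h1 n (inner ℝ ν x)| := by ring
        _ ≤ 4 * (|u x| * (|inner ℝ ν x| * |P1 (‖x‖ ^ 2)|)) * 1 := by gcongr
        _ = _ := mul_one _
    · simp only [norm_mul, Real.norm_eq_abs]
      rw [abs_of_nonneg (hh_nonneg n _), abs_of_pos hy]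
      have := hh_le n _ hy
      gcongr
  · filter_upwards [hmΩ] with x hx
    have hy := inner_pos_of_mem_halfBall hx
    have hg : Tendsto (fun n : ℕ => h1 n (inner ℝ ν x)) atTop (𝓝 1) :=
      tendsto_expNegInvGlue_atTop.comp (tendsto_atTop_add_const_right _ (-1)
        ((tendsto_atTop_add_const_right _ _ tendsto_natCast_atTop_atTop).atTop_mul_const hy))
    exact (((hg.const_mul _).mul_const _).const_mul _).add
      (((tendsto_smoothRamp_div hy).mul_const _).const_mul _)

/-! ### Logarithmic variables -/

theorem hasDerivAt_rpow_mul_comp_log {f : ℝ → ℝ} {f' q : ℝ} (m : ℝ) (hq : 0 < q)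
    (hf : HasDerivAt f f' (-Real.log q / 2)) :
    HasDerivAt (fun q => q ^ (-m) * f (-Real.log q / 2))
      (q ^ (-(m + 1)) * (-m * f (-Real.log q / 2) - f' / 2)) q := by
  have h1 := Real.hasDerivAt_rpow_const (x := q) (p := -m) (Or.inl hq.ne')
  have h2 : HasDerivAt (fun q => -Real.log q / 2) (-q⁻¹ / 2) q :=
    (Real.hasDerivAt_log hq.ne').neg.div_const 2
  refine (h1.mul (hf.comp q h2)).congr_deriv ?_
  have h3 : q ^ (-m) = q ^ (-(m + 1)) * q := by
    rw [← Real.rpow_add_one hq.ne']; congr 1; ring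
  have h4 : q ^ (-m - 1) = q ^ (-(m + 1)) := by congr 1; ring
  rw [Function.comp_apply, h3, h4]
  field_simp
  ring

theorem hasDerivAt_rpow_mul_log {K : ℝ → ℝ} {K' t : ℝ} (β : ℝ) (ht : 0 < t)
    (hK : HasDerivAt K K' (Real.log t)) :
    HasDerivAt (fun t => t ^ β * K (Real.log t))
      (t ^ (β - 1) * (β * K (Real.log t) + K')) t := by
  have h1 := Real.hasDerivAt_rpow_const (x := t) (p := β) (Or.inl ht.ne')
  refine (h1.mul (hK.comp t (Real.hasDerivAt_log ht.ne'))).congr_deriv ?_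
  have h3 : t ^ β = t ^ (β - 1) * t := by
    rw [← Real.rpow_add_one ht.ne']; congr 1; ring
  rw [Function.comp_apply, h3]
  field_simp

/-- The function `q ^ (-m) * t ^ β * K (log t)` of `q`, where `t = -(log q) / 2`, extended by zero
outside `(0, 1)`.  With `q = |x|²` one has `t = -log |x|`. -/
noncomputable def logProfile (m β : ℝ) (K : ℝ → ℝ) (q : ℝ) : ℝ :=
  open Classical in
  if q ∈ Ioo (0 : ℝ) 1 then
    q ^ (-m) * ((-Real.log q / 2) ^ β * K (Real.log (-Real.log q / 2))) else 0

theorem logProfile_eventuallyEq {m β : ℝ} {K : ℝ → ℝ} {q : ℝ} (hq : q ∈ Ioo (0 : ℝ) 1) :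
    logProfile m β K =ᶠ[𝓝 q]
      fun q => q ^ (-m) * ((-Real.log q / 2) ^ β * K (Real.log (-Real.log q / 2))) := by
  filter_upwards [isOpen_Ioo.mem_nhds hq] with p hp
  simp [logProfile, hp.1, hp.2]

theorem neg_log_half_pos {q : ℝ} (hq : q ∈ Ioo (0 : ℝ) 1) : 0 < -Real.log q / 2 := by
  have := Real.log_neg hq.1 hq.2
  linarith

theorem logProfile_nonneg {m β : ℝ} {K : ℝ → ℝ} (hK : ∀ s, 0 ≤ K s) (q : ℝ) :
    0 ≤ logProfile m β K q := by
  unfold logProfile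
  split_ifs with hq
  · have := hq.1
    have := neg_log_half_pos hq
    have := hK (Real.log (-Real.log q / 2))
    positivity
  · exact le_rfl

theorem logProfile_eq_zero {m β a b : ℝ} {K : ℝ → ℝ} (hK : ∀ s, s ∉ Icc a b → K s = 0) {q : ℝ}
    (hq : q ∉ Icc (Real.exp (-Real.exp b) ^ 2) (Real.exp (-Real.exp a) ^ 2)) :
    logProfile m β K q = 0 := by
  unfold logProfile
  split_ifs with h
  · rw [hK, mul_zero, mul_zero]
    intro hs
    have ht := neg_log_half_pos h
    have h1 := (Real.le_log_iff_exp_le ht).1 hs.1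
    have h2 := (Real.log_le_iff_le_exp ht).1 hs.2
    refine hq ⟨?_, ?_⟩
    · rw [← Real.exp_nat_mul, ← Real.le_log_iff_exp_le h.1]; push_cast; linarith
    · rw [← Real.exp_nat_mul, ← Real.log_le_iff_le_exp h.1]; push_cast; linarith
  · rfl

theorem contDiff_logProfile {m β a b : ℝ} {K : ℝ → ℝ} (hKs : ContDiff ℝ ∞ K)
    (hK : ∀ s, s ∉ Icc a b → K s = 0) : ContDiff ℝ ∞ (logProfile m β K) := by
  refine contDiff_iff_contDiffAt.2 fun q => ?_
  by_cases hq : q ∈ Ioo (0 : ℝ) 1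
  · refine ContDiffAt.congr_of_eventuallyEq ?_ (logProfile_eventuallyEq hq)
    have ht := neg_log_half_pos hq
    have h1 : ContDiffAt ℝ ∞ (fun q : ℝ => -Real.log q / 2) q :=
      (contDiffAt_id.log hq.1.ne').neg.div_const 2
    exact (contDiffAt_id.rpow_const_of_ne hq.1.ne').mul ((h1.rpow_const_of_ne ht.ne').mul
      (hKs.contDiffAt.comp q (h1.log ht.ne')))
  · have h0 : q ∉ Icc (Real.exp (-Real.exp b) ^ 2) (Real.exp (-Real.exp a) ^ 2) := fun h => by
      refine hq ⟨lt_of_lt_of_le (by positivity) h.1, h.2.trans_lt ?_⟩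
      exact pow_lt_one₀ (Real.exp_pos _).le
        (Real.exp_lt_one_iff.2 (neg_lt_zero.2 (Real.exp_pos a))) two_ne_zero
    refine contDiffAt_const (c := (0 : ℝ)).congr_of_eventuallyEq ?_
    filter_upwards [isClosed_Icc.isOpen_compl.mem_nhds h0] with p hp
    exact logProfile_eq_zero hK hp

theorem deriv_logProfile {m β : ℝ} {K : ℝ → ℝ} (hK : Differentiable ℝ K) {q : ℝ}
    (hq : q ∈ Ioo (0 : ℝ) 1) :
    deriv (logProfile m β K) q = q ^ (-(m + 1)) *
      (-m * ((-Real.log q / 2) ^ β * K (Real.log (-Real.log q / 2))) -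
        (-Real.log q / 2) ^ (β - 1) * (β * K (Real.log (-Real.log q / 2)) +
          deriv K (Real.log (-Real.log q / 2))) / 2) := by
  rw [(logProfile_eventuallyEq hq).deriv_eq]
  exact (hasDerivAt_rpow_mul_comp_log m hq.1 (hasDerivAt_rpow_mul_log β (neg_log_half_pos hq)
    (hK _).hasDerivAt)).deriv

theorem deriv_deriv_logProfile {m β : ℝ} {K : ℝ → ℝ} (hK : Differentiable ℝ K)
    (hK1 : Differentiable ℝ (deriv K)) {q : ℝ} (hq : q ∈ Ioo (0 : ℝ) 1) :
    deriv (deriv (logProfile m β K)) q = q ^ (-(m + 1 + 1)) *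
      (-(m + 1) * (-m * ((-Real.log q / 2) ^ β * K (Real.log (-Real.log q / 2))) -
        (-Real.log q / 2) ^ (β - 1) * (β * K (Real.log (-Real.log q / 2)) +
          deriv K (Real.log (-Real.log q / 2))) / 2) -
      (-m * ((-Real.log q / 2) ^ (β - 1) * (β * K (Real.log (-Real.log q / 2)) +
          deriv K (Real.log (-Real.log q / 2)))) -
        (-Real.log q / 2) ^ (β - 1 - 1) * ((β - 1) * (β * K (Real.log (-Real.log q / 2)) +
          deriv K (Real.log (-Real.log q / 2))) + (β * deriv K (Real.log (-Real.log q / 2)) +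
          deriv (deriv K) (Real.log (-Real.log q / 2)))) / 2) / 2) := by
  have ht := neg_log_half_pos hq
  have h : deriv (logProfile m β K) =ᶠ[𝓝 q] fun q => q ^ (-(m + 1)) *
      ((fun t => -m * (t ^ β * K (Real.log t)) - t ^ (β - 1) * (fun s => β * K s + deriv K s)
        (Real.log t) / 2) (-Real.log q / 2)) := by
    filter_upwards [isOpen_Ioo.mem_nhds hq] with p hp
    rw [deriv_logProfile hK hp]
  rw [h.deriv_eq]
  have h1 := hasDerivAt_rpow_mul_log β ht (hK _).hasDerivAt
  have h2 := hasDerivAt_rpow_mul_log (K := fun s => β * K s + deriv K s) (β - 1) ht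
    (((hK _).hasDerivAt.const_mul β).add (hK1 _).hasDerivAt)
  exact (hasDerivAt_rpow_mul_comp_log (m + 1) hq.1
    ((h1.const_mul (-m)).sub (h2.div_const 2))).deriv

/-- In the variable `s = log (-log |x|)` the Hardy–Leray operator applied to
`⟨ν, x⟩ |x|^(-N/2) t^(δ + 1/2) K(s)` becomes `K'' + 2δK'`, up to a positive factor. -/
theorem hardyLeray_logProfile {N : ℕ} {δ r : ℝ} {K : ℝ → ℝ} (hK : Differentiable ℝ K)
    (hK1 : Differentiable ℝ (deriv K)) (hr : r ∈ Ioo (0 : ℝ) 1) :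
    4 * r ^ 2 * deriv (deriv (logProfile (N / 4) (δ + 1 / 2) K)) (r ^ 2) +
      (2 * N + 4) * deriv (logProfile (N / 4) (δ + 1 / 2) K) (r ^ 2) +
      (N : ℝ) ^ 2 / 4 * ((r ^ 2)⁻¹ * logProfile (N / 4) (δ + 1 / 2) K (r ^ 2)) +
      (1 / 4 - δ ^ 2) * ((r ^ 2)⁻¹ * (|Real.log r| ^ 2)⁻¹ *
        logProfile (N / 4) (δ + 1 / 2) K (r ^ 2)) =
    r ^ (-(N / 2 : ℝ) - 2) * (-Real.log r) ^ (δ - 3 / 2) *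
      (deriv (deriv K) (Real.log (-Real.log r)) + 2 * δ * deriv K (Real.log (-Real.log r))) := by
  have hq : r ^ 2 ∈ Ioo (0 : ℝ) 1 := ⟨pow_pos hr.1 2, pow_lt_one₀ hr.1.le hr.2 two_ne_zero⟩
  have hlog : -Real.log (r ^ 2) / 2 = -Real.log r := by rw [Real.log_pow]; push_cast; ring
  rw [deriv_deriv_logProfile hK hK1 hq, deriv_logProfile hK hq,
    (logProfile_eventuallyEq hq).eq_of_nhds, hlog, sq_abs, ← neg_sq (Real.log r)]
  have ht : 0 < -Real.log r := neg_pos.2 (Real.log_neg hr.1 hr.2)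
  set t := -Real.log r
  have hr0 := hr.1
  have e1 : t ^ (δ + 1 / 2 - 1) = t ^ (δ - 3 / 2) * t := by
    rw [← Real.rpow_add_one ht.ne']; congr 1; ring
  have e2 : t ^ (δ + 1 / 2) = t ^ (δ - 3 / 2) * t ^ 2 := by
    rw [← Real.rpow_add_natCast ht.ne']; congr 1; push_cast; ring
  have e3 : t ^ (δ + 1 / 2 - 1 - 1) = t ^ (δ - 3 / 2) := by congr 1; ring
  have e4 : (r ^ 2) ^ (-(N / 4 + 1 + 1) : ℝ) = r ^ (-(N / 2 : ℝ) - 2) / r ^ 2 := by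
    rw [← Real.rpow_natCast r 2, ← Real.rpow_mul hr0.le, ← Real.rpow_sub hr0]
    congr 1; push_cast; ring
  have e5 : (r ^ 2) ^ (-(N / 4 + 1) : ℝ) = r ^ (-(N / 2 : ℝ) - 2) := by
    rw [← Real.rpow_natCast r 2, ← Real.rpow_mul hr0.le]
    congr 1; push_cast; ring
  have e6 : (r ^ 2) ^ (-(N / 4) : ℝ) = r ^ (-(N / 2 : ℝ) - 2) * r ^ 2 := by
    rw [← Real.rpow_natCast r 2, ← Real.rpow_mul hr0.le, ← Real.rpow_add hr0]
    congr 1; push_cast; ring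
  rw [e1, e2, e3, e4, e5, e6]
  field_simp
  ring

/-- Testing with `⟨ν, x⟩ |x|^(-N/2) t^(δ + 1/2) K(s)`. -/
theorem integral_logProfile_nonpos {N : ℕ} {ν : RN N} (hν : ‖ν‖ = 1) {R δ γ : ℝ}
    {u : RN N → ℝ} (hR : R ≤ 1)
    (hu0 : ∀ᵐ x ∂(volume.restrict (halfBall ν R)), 0 ≤ u x)
    (hsol : IsDistributionalSolution (halfBall ν R) ((N : ℝ) ^ 2 / 4) (1 / 4 - δ ^ 2) u)
    (hu : Integrable (fun x => u x ^ 2 * hardyLerayWeight γ x) (volume.restrict (halfBall ν R)))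
    {a b : ℝ} (hab : a ≤ b) (ha : Real.exp (-Real.exp a) < R) {K : ℝ → ℝ} (hKs : ContDiff ℝ ∞ K)
    (hKnn : ∀ s, 0 ≤ K s) (hK0 : ∀ s, s ∉ Icc a b → K s = 0) :
    ∫ x in halfBall ν R, u x * (inner ℝ ν x * (‖x‖ ^ (-(N / 2 : ℝ) - 2) *
      (-Real.log ‖x‖) ^ (δ - 3 / 2) * (deriv (deriv K) (Real.log (-Real.log ‖x‖)) +
        2 * δ * deriv K (Real.log (-Real.log ‖x‖))))) ≤ 0 := by
  have h := integral_inner_mul_radial_nonpos hν hR hu0 hsol hu (r₁ := Real.exp (-Real.exp b))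
    (Real.exp_pos _) (Real.exp_le_exp.2 (neg_le_neg (Real.exp_le_exp.2 hab))) ha
    (contDiff_logProfile (m := N / 4) (β := δ + 1 / 2) hKs hK0) (logProfile_nonneg hKnn)
    fun q hq => logProfile_eq_zero hK0 hq
  have hK1 : ContDiff ℝ ∞ (deriv K) := (contDiff_infty_iff_deriv.1 hKs).2
  refine (integral_congr_ae ?_).trans_le h
  filter_upwards [ae_restrict_mem (isOpen_halfBall ν R).measurableSet] with x hx
  rw [hardyLeray_logProfile (hKs.differentiable (by simp)) (hK1.differentiable (by simp))
    ⟨norm_pos_of_mem_halfBall hx, (norm_lt_of_mem_halfBall hx).trans_le hR⟩]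

/-! ### Logarithmic cutoffs -/

theorem exists_bound_deriv_smoothTransition :
    ∃ C : ℝ, 0 ≤ C ∧ (∀ s, |deriv Real.smoothTransition s| ≤ C) ∧
      (∀ s, |deriv (deriv Real.smoothTransition) s| ≤ C) ∧
      (∀ s, s ∉ Icc (0 : ℝ) 1 → deriv Real.smoothTransition s = 0) ∧
      ∀ s, s ∉ Icc (0 : ℝ) 1 → deriv (deriv Real.smoothTransition) s = 0 := by
  have h1 : ∀ s, s ∉ Icc (0 : ℝ) 1 → deriv Real.smoothTransition s = 0 := by
    intro s hs
    rcases lt_or_ge s 0 with h | h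
    · have he : Real.smoothTransition =ᶠ[𝓝 s] fun _ => 0 := by
        filter_upwards [gt_mem_nhds h] with r hr using Real.smoothTransition.zero_of_nonpos hr.le
      rw [he.deriv_eq, deriv_const]
    · have h' : 1 < s := not_le.1 fun h' => hs ⟨h, h'⟩
      have he : Real.smoothTransition =ᶠ[𝓝 s] fun _ => 1 := by
        filter_upwards [lt_mem_nhds h'] with r hr using Real.smoothTransition.one_of_one_le hr.le
      rw [he.deriv_eq, deriv_const]
  have h2 : ∀ s, s ∉ Icc (0 : ℝ) 1 → deriv (deriv Real.smoothTransition) s = 0 :=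
    fun s hs => deriv_eq_zero_of_notMem isClosed_Icc h1 hs
  have hc : ContDiff ℝ ∞ (deriv Real.smoothTransition) :=
    (contDiff_infty_iff_deriv.1 Real.smoothTransition.contDiff).2
  have hc2 : ContDiff ℝ ∞ (deriv (deriv Real.smoothTransition)) :=
    (contDiff_infty_iff_deriv.1 hc).2
  obtain ⟨C1, hC1⟩ := (isCompact_Icc (a := (0 : ℝ)) (b := 1)).exists_bound_of_continuousOn
    hc.continuous.continuousOn
  obtain ⟨C2, hC2⟩ := (isCompact_Icc (a := (0 : ℝ)) (b := 1)).exists_bound_of_continuousOn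
    hc2.continuous.continuousOn
  refine ⟨max 0 (max C1 C2), le_max_left _ _, fun s => ?_, fun s => ?_, h1, h2⟩
  · by_cases hs : s ∈ Icc (0 : ℝ) 1
    · exact (hC1 s hs).trans ((le_max_left _ _).trans (le_max_right _ _))
    · rw [h1 s hs, abs_zero]; exact le_max_left _ _
  · by_cases hs : s ∈ Icc (0 : ℝ) 1
    · exact (hC2 s hs).trans ((le_max_right _ _).trans (le_max_right _ _))
    · rw [h2 s hs, abs_zero]; exact le_max_left _ _

/-- The truncations at scale `n` of the ramp are subsolutions of `K'' + 2δK' = 0` up to an error of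
size `1 / n` on `[n, 2n]`. -/
theorem exists_compactly_supported_subsolution {δ : ℝ} (hδ : 0 ≤ δ) (a : ℝ) :
    ∃ C : ℝ, 0 ≤ C ∧ ∀ n : ℕ, 1 ≤ n → a ≤ n → ∃ K : ℝ → ℝ, ContDiff ℝ ∞ K ∧ (∀ s, 0 ≤ K s) ∧
      (∀ s, s ∉ Icc a (2 * n) → K s = 0) ∧
      ∀ s, indicator (Iic (n : ℝ)) (fun s => Real.exp (-2 * δ * s) * expNegInvGlueDeriv (s - a)) s -
        indicator (Icc (n : ℝ) (2 * n)) (fun _ => C / n) s ≤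
          deriv (deriv K) s + 2 * δ * deriv K s := by
  obtain ⟨C, hC0, hC1, hC2, hz1, hz2⟩ := exists_bound_deriv_smoothTransition
  set E := Real.exp (-2 * δ * a) with hE
  have hEp : 0 < E := Real.exp_pos _
  refine ⟨E * C * (5 + |a|), by positivity, fun n hn han => ?_⟩
  have hn1 : (1 : ℝ) ≤ n := by exact_mod_cast hn
  have hn0 : (0 : ℝ) < n := by linarith
  set k := smoothRamp δ a
  set k1 : ℝ → ℝ := fun s => Real.exp (-2 * δ * s) * expNegInvGlue (s - a)
  set k2 : ℝ → ℝ := fun s =>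
    Real.exp (-2 * δ * s) * (expNegInvGlueDeriv (s - a) - 2 * δ * expNegInvGlue (s - a))
  set S := Real.smoothTransition
  set X : ℝ → ℝ := fun s => S (2 - s / n) with hX
  set X1 : ℝ → ℝ := fun s => -(deriv S (2 - s / n) / n) with hX1
  set X2 : ℝ → ℝ := fun s => deriv (deriv S) (2 - s / n) / n / n with hX2
  have hS : ContDiff ℝ ∞ S := Real.smoothTransition.contDiff
  have hS1 : ContDiff ℝ ∞ (deriv S) := (contDiff_infty_iff_deriv.1 hS).2
  have hlin : ∀ s : ℝ, HasDerivAt (fun s : ℝ => 2 - s / n) (-(1 / n)) s := fun s =>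
    ((hasDerivAt_id s).div_const (n : ℝ)).const_sub 2
  have hdX : ∀ s, HasDerivAt X (X1 s) s := fun s =>
    ((hS.differentiable (by simp) _).hasDerivAt.comp s (hlin s)).congr_deriv (by
      simp only [hX1]; ring)
  have hdX1 : ∀ s, HasDerivAt X1 (X2 s) s := fun s =>
    ((((hS1.differentiable (by simp) _).hasDerivAt.comp s (hlin s)).div_const (n : ℝ)).neg).congr_deriv
      (by simp only [hX2]; ring)
  have hK1 : deriv (fun s => k s * X s) = fun s => k1 s * X s + k s * X1 s :=
    funext fun s => ((hasDerivAt_smoothRamp δ a s).mul (hdX s)).deriv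
  have hK2 : deriv (deriv fun s => k s * X s) = fun s =>
      k2 s * X s + k1 s * X1 s + (k1 s * X1 s + k s * X2 s) := by
    rw [hK1]
    exact funext fun s => (((hasDerivAt_smoothRamp_deriv δ a s).mul (hdX s)).add
      ((hasDerivAt_smoothRamp δ a s).mul (hdX1 s))).deriv
  refine ⟨fun s => k s * X s, (contDiff_smoothRamp δ a).mul
    (hS.comp (contDiff_const.sub (contDiff_id.div_const _))), fun s =>
      mul_nonneg (smoothRamp_nonneg _ _ _) (Real.smoothTransition.nonneg _), fun s hs => ?_,
      fun s => ?_⟩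
  · rcases le_total s a with h | h
    · simp only [k, smoothRamp_of_le h, zero_mul]
    · have h2 : 2 * (n : ℝ) < s := not_le.1 fun h' => hs ⟨h, h'⟩
      have h3 : 2 - s / n ≤ 0 := by
        rw [sub_nonpos, le_div_iff₀ hn0]; exact h2.le
      simp only [hX, S, Real.smoothTransition.zero_of_nonpos h3, mul_zero]
  rw [hK2, hK1]
  simp only
  have hmain : k2 s * X s + 2 * δ * (k1 s * X s) =
      Real.exp (-2 * δ * s) * expNegInvGlueDeriv (s - a) * X s := by simp only [k1, k2]; ring
  have hfirst : indicator (Iic (n : ℝ))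
      (fun s => Real.exp (-2 * δ * s) * expNegInvGlueDeriv (s - a)) s ≤
      Real.exp (-2 * δ * s) * expNegInvGlueDeriv (s - a) * X s := by
    have hp : 0 ≤ Real.exp (-2 * δ * s) * expNegInvGlueDeriv (s - a) :=
      mul_nonneg (Real.exp_pos _).le (expNegInvGlueDeriv_nonneg _)
    by_cases hs : s ∈ Iic (n : ℝ)
    · have h1 : 1 ≤ 2 - s / n := by
        have : s / n ≤ 1 := (div_le_one hn0).2 hs
        linarith
      rw [indicator_of_mem hs]
      simp only [hX, S, Real.smoothTransition.one_of_one_le h1, mul_one, le_refl]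
    · rw [indicator_of_notMem hs]
      exact mul_nonneg hp (Real.smoothTransition.nonneg _)
  have herr : |2 * k1 s * X1 s + k s * X2 s + 2 * δ * k s * X1 s| ≤
      indicator (Icc (n : ℝ) (2 * n)) (fun _ => E * C * (5 + |a|) / n) s := by
    by_cases hs : s ∈ Icc (n : ℝ) (2 * n)
    · rw [indicator_of_mem hs]
      have has : a ≤ s := han.trans hs.1
      have hk1 : |k1 s| ≤ E := by
        rw [abs_of_nonneg (mul_nonneg (Real.exp_pos _).le (expNegInvGlue.nonneg _))]
        have h2 : Real.exp (-2 * δ * s) ≤ E := Real.exp_le_exp.2 (by nlinarith)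
        calc _ ≤ E * 1 := mul_le_mul h2 (expNegInvGlue_le_one _) (expNegInvGlue.nonneg _) hEp.le
          _ = E := mul_one _
      have hk0 := smoothRamp_nonneg δ a s
      have hk : |k s| ≤ E * ((2 + |a|) * n) := by
        rw [abs_of_nonneg hk0]
        refine (smoothRamp_le hδ has).trans (mul_le_mul_of_nonneg_left ?_ hEp.le)
        have := hs.2
        nlinarith [neg_abs_le a, abs_nonneg a]
      have hδk : |2 * δ * k s| ≤ E := by
        rw [abs_of_nonneg (by positivity)]
        exact two_mul_smoothRamp_le hδ a s
      have hx1 : |X1 s| ≤ C / n := by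
        simp only [hX1, abs_neg, abs_div, abs_of_pos hn0]
        exact div_le_div_of_nonneg_right (hC1 _) hn0.le
      have hx2 : |X2 s| ≤ C / n / n := by
        simp only [hX2, abs_div, abs_of_pos hn0]
        exact div_le_div_of_nonneg_right (div_le_div_of_nonneg_right (hC2 _) hn0.le) hn0.le
      calc _ ≤ |2 * k1 s * X1 s| + |k s * X2 s| + |2 * δ * k s * X1 s| :=
            (abs_add_le _ _).trans (add_le_add_left (abs_add_le _ _) _)
        _ = 2 * |k1 s| * |X1 s| + |k s| * |X2 s| + |2 * δ * k s| * |X1 s| := by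
            rw [abs_mul, abs_mul, abs_mul (k s), abs_mul (2 * δ * k s), abs_two]
        _ ≤ 2 * E * (C / n) + E * ((2 + |a|) * n) * (C / n / n) + E * (C / n) := by gcongr
        _ = E * C * (5 + |a|) / n := by field_simp; ring
    · rw [indicator_of_notMem hs]
      have h01 : 2 - s / n ∉ Icc (0 : ℝ) 1 := fun h => hs ⟨by
        have := (le_div_iff₀ hn0).1 (by linarith [h.2] : 1 ≤ s / n)
        linarith, by
        have := (div_le_iff₀ hn0).1 (by linarith [h.1] : s / n ≤ 2)
        linarith⟩
      have e1 : X1 s = 0 := by simp only [hX1, S, hz1 _ h01, zero_div, neg_zero]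
      have e2 : X2 s = 0 := by simp only [hX2, S, hz2 _ h01, zero_div]
      simp [e1, e2]
  have := (abs_le.1 herr).1
  linarith

/-! ### A radial integral -/

/-- In polar coordinates `|x|^(-N) t⁻¹ dx` with `t = -log |x|` is a multiple of `ds`,
where `s = log t`. -/
theorem integral_radial_log {N : ℕ} (hN : 1 ≤ N) :
    ∃ D : ℝ, 0 ≤ D ∧ ∀ p q : ℝ, p ≤ q →
      Integrable (fun x : RN N => indicator (Icc (Real.exp (-Real.exp q)) (Real.exp (-Real.exp p)))
        (fun r => (r ^ N)⁻¹ * (-Real.log r)⁻¹) ‖x‖) volume ∧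
      ∫ x : RN N, indicator (Icc (Real.exp (-Real.exp q)) (Real.exp (-Real.exp p)))
        (fun r => (r ^ N)⁻¹ * (-Real.log r)⁻¹) ‖x‖ = D * (q - p) := by
  have : Nonempty (Fin N) := ⟨⟨0, hN⟩⟩
  have : Nontrivial (RN N) := inferInstance
  refine ⟨N * volume.real (Metric.ball (0 : RN N) 1), by positivity, fun p q hpq => ?_⟩
  set ρ₁ := Real.exp (-Real.exp q) with hρ₁
  set ρ₂ := Real.exp (-Real.exp p) with hρ₂
  have h1 : 0 < ρ₁ := Real.exp_pos _
  have h12 : ρ₁ ≤ ρ₂ := Real.exp_le_exp.2 (neg_le_neg (Real.exp_le_exp.2 hpq))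
  have h2 : ρ₂ < 1 := Real.exp_lt_one_iff.2 (neg_lt_zero.2 (Real.exp_pos p))
  have hpos : ∀ r ∈ Icc ρ₁ ρ₂, 0 < r ∧ Real.log r < 0 := fun r hr =>
    ⟨h1.trans_le hr.1, Real.log_neg (h1.trans_le hr.1) (hr.2.trans_lt h2)⟩
  have hcont : ContinuousOn (fun r : ℝ => r⁻¹ * (-Real.log r)⁻¹) (Icc ρ₁ ρ₂) :=
    (continuousOn_id.inv₀ fun r hr => (hpos r hr).1.ne').mul
      ((continuousOn_id.log fun r hr => (hpos r hr).1.ne').neg.inv₀ fun r hr =>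
        (neg_pos.2 (hpos r hr).2).ne')
  have heq : (fun y : ℝ => y ^ (N - 1) • indicator (Icc ρ₁ ρ₂)
      (fun r => (r ^ N)⁻¹ * (-Real.log r)⁻¹) y) =
      indicator (Icc ρ₁ ρ₂) fun r => r⁻¹ * (-Real.log r)⁻¹ := by
    funext y
    by_cases hy : y ∈ Icc ρ₁ ρ₂
    · have hy0 : y ≠ 0 := (hpos y hy).1.ne'
      rw [indicator_of_mem hy, indicator_of_mem hy, smul_eq_mul, ← mul_assoc]
      congr 1
      obtain ⟨M, rfl⟩ := Nat.exists_eq_add_of_le' hN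
      rw [Nat.add_sub_cancel, pow_succ]
      field_simp
    · rw [indicator_of_notMem hy, indicator_of_notMem hy, smul_zero]
  have hioi : Icc ρ₁ ρ₂ ⊆ Ioi 0 := fun r hr => (hpos r hr).1
  constructor
  · rw [integrable_fun_norm_addHaar volume (f := indicator (Icc ρ₁ ρ₂)
      (fun r => (r ^ N)⁻¹ * (-Real.log r)⁻¹)), finrank_euclideanSpace_fin, heq]
    exact (hcont.integrableOn_Icc.integrable_indicator measurableSet_Icc).integrableOn
  · rw [integral_fun_norm_addHaar volume (f := indicator (Icc ρ₁ ρ₂)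
      (fun r => (r ^ N)⁻¹ * (-Real.log r)⁻¹)), finrank_euclideanSpace_fin, heq,
      setIntegral_indicator measurableSet_Icc, inter_eq_self_of_subset_right hioi,
      integral_Icc_eq_integral_Ioc, ← intervalIntegral.integral_of_le h12]
    have hd : ∀ r ∈ uIcc ρ₁ ρ₂, HasDerivAt (fun r => -Real.log (-Real.log r))
        (r⁻¹ * (-Real.log r)⁻¹) r := by
      intro r hr
      rw [uIcc_of_le h12] at hr
      obtain ⟨h3, h4⟩ := hpos r hr
      refine (((Real.hasDerivAt_log h3.ne').neg.log (neg_pos.2 h4).ne').neg).congr_deriv ?_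
      rw [div_eq_mul_inv, Pi.neg_apply, inv_neg]; ring
    rw [intervalIntegral.integral_eq_sub_of_hasDerivAt hd
      (ContinuousOn.intervalIntegrable (by rwa [uIcc_of_le h12]))]
    simp only [hρ₁, hρ₂, Real.log_exp, neg_neg, nsmul_eq_mul, smul_eq_mul]
    ring

/-! ### Vanishing of the solution -/

theorem mem_Icc_exp_neg_exp {r p q : ℝ} (hr : r ∈ Ioo (0 : ℝ) 1) :
    r ∈ Icc (Real.exp (-Real.exp q)) (Real.exp (-Real.exp p)) ↔
      Real.log (-Real.log r) ∈ Icc p q := by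
  have ht : 0 < -Real.log r := neg_pos.2 (Real.log_neg hr.1 hr.2)
  rw [mem_Icc, mem_Icc, ← Real.le_log_iff_exp_le hr.1, ← Real.log_le_iff_le_exp hr.1,
    Real.le_log_iff_exp_le ht, Real.log_le_iff_le_exp ht, le_neg, neg_le, and_comm]

/-- The Cauchy–Schwarz inequality, pointwise and weighted by `j`, between the solution and the
truncation error of the test function. -/
theorem mul_le_weighted_sq {N : ℕ} {r t U y δ c j : ℝ} (hr : 0 < r) (ht : 0 < t)
    (hU : 0 ≤ U) (hy : y ≤ r) (hc : 0 ≤ c) (hj : 0 < j) :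
    U * (y * (r ^ (-(N / 2 : ℝ) - 2) * t ^ (δ - 3 / 2) * c)) ≤
      (j⁻¹ * (U ^ 2 * ((r ^ 2)⁻¹ * t ^ (-2 * (1 - δ)))) + j * c ^ 2 * ((r ^ N)⁻¹ * t⁻¹)) / 2 := by
  set A := U * (r⁻¹ * t ^ (δ - 1)) with hA
  set B := r ^ (-(N / 2 : ℝ)) * t ^ (-(1 / 2) : ℝ) * c with hB
  have hAB : U * (r * (r ^ (-(N / 2 : ℝ) - 2) * t ^ (δ - 3 / 2) * c)) = A * B := by
    have e1 : r ^ (-(N / 2 : ℝ) - 2) = r ^ (-(N / 2 : ℝ)) / r ^ 2 := by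
      rw [Real.rpow_sub hr]; norm_num
    have e2 : t ^ (δ - 3 / 2) = t ^ (δ - 1) * t ^ (-(1 / 2) : ℝ) := by
      rw [← Real.rpow_add ht]; congr 1; ring
    rw [e1, e2, hA, hB]
    field_simp
  have hA2 : A ^ 2 = U ^ 2 * ((r ^ 2)⁻¹ * t ^ (-2 * (1 - δ))) := by
    rw [hA, mul_pow, mul_pow, ← Real.rpow_mul_natCast ht.le, inv_pow]
    congr 3; push_cast; ring
  have hB2 : B ^ 2 = c ^ 2 * ((r ^ N)⁻¹ * t⁻¹) := by
    rw [hB, mul_pow, mul_pow, ← Real.rpow_mul_natCast ht.le, ← Real.rpow_mul_natCast hr.le,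
      ← Real.rpow_natCast r N, ← Real.rpow_neg hr.le, ← Real.rpow_neg_one t, mul_comm]
    congr 3
    · push_cast; ring
    · push_cast; ring
  have h1 : U * (y * (r ^ (-(N / 2 : ℝ) - 2) * t ^ (δ - 3 / 2) * c)) ≤ A * B := by
    rw [← hAB]; gcongr
  have h2 : 0 ≤ j⁻¹ * (A - j * B) ^ 2 := by positivity
  have h3 : j⁻¹ * (A - j * B) ^ 2 = j⁻¹ * A ^ 2 - 2 * (A * B) + j * B ^ 2 := by
    field_simp; ring
  rw [← hA2, mul_assoc j, ← hB2]
  linarith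

/-- The solution vanishes where `s = log (-log |x|)` exceeds `a`: the test functions built from the
truncated ramps starting at `a` are strict subsolutions there, up to errors that tend to zero. -/
theorem ae_eq_zero_of_lt_log {N : ℕ} (hN : 1 ≤ N) {ν : RN N} (hν : ‖ν‖ = 1) {R δ : ℝ}
    {u : RN N → ℝ} (hR : R ≤ 1) (hδ : 0 ≤ δ)
    (hu0 : ∀ᵐ x ∂(volume.restrict (halfBall ν R)), 0 ≤ u x)
    (hsol : IsDistributionalSolution (halfBall ν R) ((N : ℝ) ^ 2 / 4) (1 / 4 - δ ^ 2) u)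
    (hu : Integrable (fun x => u x ^ 2 * hardyLerayWeight (1 - δ) x)
      (volume.restrict (halfBall ν R)))
    {a : ℝ} (ha : Real.exp (-Real.exp a) < R) :
    ∀ᵐ x ∂(volume.restrict (halfBall ν R)), a < Real.log (-Real.log ‖x‖) → u x = 0 := by
  set Ω := halfBall ν R with hΩ
  have hum : AEStronglyMeasurable u (volume.restrict Ω) :=
    hsol.locallyIntegrableOn.aestronglyMeasurable
  have hmΩ : ∀ᵐ x ∂(volume.restrict Ω), x ∈ Ω :=
    ae_restrict_mem (isOpen_halfBall ν R).measurableSet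
  have hr01 : ∀ x ∈ Ω, ‖x‖ ∈ Ioo (0 : ℝ) 1 := fun x hx =>
    ⟨norm_pos_of_mem_halfBall hx, (norm_lt_of_mem_halfBall hx).trans_le hR⟩
  have hym : Measurable fun x : RN N => inner ℝ ν x :=
    (by fun_prop : Continuous fun x : RN N => inner ℝ ν x).measurable
  have hyabs : ∀ x ∈ Ω, |inner ℝ ν x| ≤ 1 := fun x hx => by
    rw [abs_of_pos (inner_pos_of_mem_halfBall hx)]
    exact (inner_le_norm_of_norm_eq_one hν x).trans (hr01 x hx).2.le
  set G : ℝ → ℝ := fun r => r ^ (-(N / 2 : ℝ) - 2) * (-Real.log r) ^ (δ - 3 / 2) with hG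
  have hGm : Measurable G :=
    (measurable_id.pow_const _).mul (Real.measurable_log.neg.pow_const _)
  have hGpos : ∀ r ∈ Ioo (0 : ℝ) 1, 0 < G r := fun r hr => by
    have h1 := hr.1
    have h2 := neg_pos.2 (Real.log_neg hr.1 hr.2)
    simp only [hG]; positivity
  have hlm : Measurable fun r : ℝ => Real.log (-Real.log r) :=
    Real.measurable_log.comp Real.measurable_log.neg
  -- radial functions that are supported where `a ≤ s ≤ q`
  have hint : ∀ (q : ℝ) (H H' : ℝ → ℝ), Measurable H → Continuous H' →
      (∀ s ∈ Icc a q, H s = H' s) → (∀ s, s ∉ Icc a q → H s = 0) →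
      Integrable (fun x => u x * (inner ℝ ν x * (G ‖x‖ * H (Real.log (-Real.log ‖x‖)))))
        (volume.restrict Ω) := by
    intro q H H' hH hH' heq hz
    have h01 : ∀ r ∈ Icc (Real.exp (-Real.exp q)) (Real.exp (-Real.exp a)), r ∈ Ioo (0 : ℝ) 1 :=
      fun r hr => ⟨(Real.exp_pos _).trans_le hr.1, (hr.2.trans_lt ha).trans_le hR⟩
    have hlog : ContinuousOn (fun r : ℝ => -Real.log r)
        (Icc (Real.exp (-Real.exp q)) (Real.exp (-Real.exp a))) :=
      (continuousOn_id.log fun r hr => (h01 r hr).1.ne').neg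
    have hlogpos : ∀ r ∈ Icc (Real.exp (-Real.exp q)) (Real.exp (-Real.exp a)),
        -Real.log r ≠ 0 := fun r hr =>
      (neg_pos.2 (Real.log_neg (h01 r hr).1 (h01 r hr).2)).ne'
    refine integrable_mul_radial hR hum hu (r₁ := Real.exp (-Real.exp q)) (Real.exp_pos _) ha hym
      hyabs (F := fun r => G r * H (Real.log (-Real.log r))) (hGm.mul (hH.comp hlm)) ?_ ?_
    · have hc : ContinuousOn (fun r => G r * H' (Real.log (-Real.log r)))
          (Icc (Real.exp (-Real.exp q)) (Real.exp (-Real.exp a))) :=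
        ((continuousOn_id.rpow_const fun r hr => Or.inl (h01 r hr).1.ne').mul
          (hlog.rpow_const fun r hr => Or.inl (hlogpos r hr))).mul
          (hH'.comp_continuousOn (hlog.log hlogpos))
      refine hc.congr fun r hr => ?_
      simp only [heq _ ((mem_Icc_exp_neg_exp (h01 r hr)).1 hr)]
    · intro r hr hn
      have h1 : r ∈ Ioo (0 : ℝ) 1 := ⟨hr.1, hr.2.trans_le hR⟩
      simp only [hz _ fun h => hn ((mem_Icc_exp_neg_exp h1).2 h), mul_zero]
  set g : ℝ → ℝ := fun s => Real.exp (-2 * δ * s) * expNegInvGlueDeriv (s - a) with hg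
  have hgc : Continuous g := (by fun_prop : Continuous fun s : ℝ => Real.exp (-2 * δ * s)).mul
    (continuous_expNegInvGlueDeriv.comp (by fun_prop))
  have hg0 : ∀ s, 0 ≤ g s := fun s => mul_nonneg (Real.exp_pos _).le (expNegInvGlueDeriv_nonneg _)
  set Ψ : ℕ → RN N → ℝ := fun m x => u x * (inner ℝ ν x *
    (G ‖x‖ * indicator (Iic (m : ℝ)) g (Real.log (-Real.log ‖x‖)))) with hΨ
  have hΨi : ∀ m, Integrable (Ψ m) (volume.restrict Ω) := fun m => by
    refine hint m _ g (hgc.measurable.indicator measurableSet_Iic) hgc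
      (fun s hs => indicator_of_mem (show s ∈ Iic (m : ℝ) from hs.2) g) fun s hs => ?_
    by_cases hsm : s ∈ Iic (m : ℝ)
    · have : s - a ≤ 0 := sub_nonpos.2 (not_le.1 fun h => hs ⟨h, hsm⟩).le
      rw [indicator_of_mem hsm]
      simp only [hg, expNegInvGlueDeriv_of_nonpos this, mul_zero]
    · exact indicator_of_notMem hsm g
  have hΨ0 : ∀ m, 0 ≤ᵐ[volume.restrict Ω] Ψ m := fun m => by
    filter_upwards [hmΩ, hu0] with x hx hux
    exact mul_nonneg hux (mul_nonneg (inner_pos_of_mem_halfBall hx).le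
      (mul_nonneg (hGpos _ (hr01 x hx)).le (indicator_nonneg (fun s _ => hg0 s) _)))
  obtain ⟨C, hC0, hC⟩ := exists_compactly_supported_subsolution hδ a
  obtain ⟨D, hD0, hD⟩ := integral_radial_log hN
  set M := ∫ x in Ω, u x ^ 2 * hardyLerayWeight (1 - δ) x with hM
  -- with the truncation at `n = j ^ 2` and the weight `j` the errors are of size `1 / j`
  have hbound : ∀ m j : ℕ, 1 ≤ j → m ≤ j → a ≤ j →
      ∫ x in Ω, Ψ m x ≤ (M + C ^ 2 * D) / 2 / j := by
    intro m j hj hmj haj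
    have hj1 : (1 : ℝ) ≤ j := by exact_mod_cast hj
    have hj0 : (0 : ℝ) < j := by linarith
    have hjj : j ≤ j ^ 2 := Nat.le_self_pow two_ne_zero j
    have hjj' : (j : ℝ) ≤ (j ^ 2 : ℕ) := by exact_mod_cast hjj
    set n := j ^ 2 with hn
    obtain ⟨K, hKs, hK0, hKz, hK⟩ := hC n (hj.trans hjj) (haj.trans hjj')
    have hn0 : (0 : ℝ) < n := hj0.trans_le hjj'
    have han : a ≤ 2 * n := by linarith
    have hK1 : ContDiff ℝ ∞ (deriv K) := (contDiff_infty_iff_deriv.1 hKs).2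
    have hK2 : ContDiff ℝ ∞ (deriv (deriv K)) := (contDiff_infty_iff_deriv.1 hK1).2
    have hz1 := fun s hs => deriv_eq_zero_of_notMem (r := s) isClosed_Icc hKz hs
    have hz2 := fun s hs => deriv_eq_zero_of_notMem (r := s) isClosed_Icc hz1 hs
    have hle := integral_logProfile_nonpos hν hR hu0 hsol hu han ha hKs hK0 hKz
    have hLc : Continuous fun s => deriv (deriv K) s + 2 * δ * deriv K s :=
      hK2.continuous.add (hK1.continuous.const_mul _)
    have hLi := hint (2 * n) _ _ hLc.measurable hLc (fun s _ => rfl) fun s hs => by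
      rw [hz1 s hs, hz2 s hs, mul_zero, add_zero]
    obtain ⟨hfi, hfv⟩ := hD n (2 * n) (by linarith)
    set f : RN N → ℝ := fun x =>
      indicator (Icc (Real.exp (-Real.exp (2 * n))) (Real.exp (-Real.exp n)))
        (fun r => (r ^ N)⁻¹ * (-Real.log r)⁻¹) ‖x‖ with hf
    have hf0 : ∀ x, 0 ≤ f x := fun x => by
      refine indicator_nonneg (fun r hr => ?_) _
      have h1 : 0 < r := (Real.exp_pos _).trans_le hr.1
      have h2 : r < 1 := hr.2.trans_lt (Real.exp_lt_one_iff.2 (neg_lt_zero.2 (Real.exp_pos _)))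
      have h3 := neg_pos.2 (Real.log_neg h1 h2)
      positivity
    have hfΩ : ∫ x in Ω, f x ≤ D * n := by
      refine (setIntegral_le_integral hfi (ae_of_all _ hf0)).trans_eq (hfv.trans ?_)
      ring
    have hrhs : Integrable (fun x => ((j : ℝ)⁻¹ * (u x ^ 2 * hardyLerayWeight (1 - δ) x) +
        j * (C / n) ^ 2 * f x) / 2) (volume.restrict Ω) :=
      ((hu.const_mul _).add (hfi.restrict.const_mul _)).div_const 2
    have hmono : ∫ x in Ω, Ψ m x ≤ ∫ x in Ω, (u x * (inner ℝ ν x * (G ‖x‖ *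
        (deriv (deriv K) (Real.log (-Real.log ‖x‖)) +
          2 * δ * deriv K (Real.log (-Real.log ‖x‖))))) +
        ((j : ℝ)⁻¹ * (u x ^ 2 * hardyLerayWeight (1 - δ) x) + j * (C / n) ^ 2 * f x) / 2) := by
      refine integral_mono_ae (hΨi m) (hLi.add hrhs) ?_
      filter_upwards [hmΩ, hu0] with x hx hux
      have hr := hr01 x hx
      have hy := inner_pos_of_mem_halfBall hx
      have ht : 0 < -Real.log ‖x‖ := neg_pos.2 (Real.log_neg hr.1 hr.2)
      have hGp := hGpos _ hr
      set s := Real.log (-Real.log ‖x‖) with hs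
      have h1 : Ψ m x ≤ u x * (inner ℝ ν x * (G ‖x‖ * indicator (Iic (n : ℝ)) g s)) := by
        have : indicator (Iic (m : ℝ)) g s ≤ indicator (Iic (n : ℝ)) g s :=
          indicator_le_indicator_of_subset
            (Iic_subset_Iic.2 (by exact_mod_cast hmj.trans hjj)) (fun s => hg0 s) s
        simp only [hΨ]
        gcongr
      have h2 : u x * (inner ℝ ν x * (G ‖x‖ * (indicator (Iic (n : ℝ)) g s -
          indicator (Icc (n : ℝ) (2 * n)) (fun _ => C / n) s))) ≤
          u x * (inner ℝ ν x * (G ‖x‖ * (deriv (deriv K) s + 2 * δ * deriv K s))) := by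
        have := hK s
        gcongr
      have h3 : u x * (inner ℝ ν x * (G ‖x‖ *
          indicator (Icc (n : ℝ) (2 * n)) (fun _ => C / n) s)) ≤
          ((j : ℝ)⁻¹ * (u x ^ 2 * hardyLerayWeight (1 - δ) x) + j * (C / n) ^ 2 * f x) / 2 := by
        have hw := hardyLerayWeight_nonneg (1 - δ) x
        by_cases hsn : s ∈ Icc (n : ℝ) (2 * n)
        · have hfx : f x = (‖x‖ ^ N)⁻¹ * (-Real.log ‖x‖)⁻¹ :=
            indicator_of_mem ((mem_Icc_exp_neg_exp hr).2 hsn) _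
          rw [indicator_of_mem hsn, hfx, hardyLerayWeight, abs_of_neg (neg_pos.1 ht)]
          exact mul_le_weighted_sq hr.1 ht hux (inner_le_norm_of_norm_eq_one hν x)
            (by positivity) hj0
        · have := hf0 x
          rw [indicator_of_notMem hsn, mul_zero, mul_zero, mul_zero]
          positivity
      have h4 : u x * (inner ℝ ν x * (G ‖x‖ * (indicator (Iic (n : ℝ)) g s -
          indicator (Icc (n : ℝ) (2 * n)) (fun _ => C / n) s))) =
          u x * (inner ℝ ν x * (G ‖x‖ * indicator (Iic (n : ℝ)) g s)) -
          u x * (inner ℝ ν x * (G ‖x‖ *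
            indicator (Icc (n : ℝ) (2 * n)) (fun _ => C / n) s)) := by ring
      linarith
    rw [integral_add hLi hrhs, integral_div,
      integral_add (hu.const_mul _) (hfi.restrict.const_mul _), integral_const_mul,
      integral_const_mul] at hmono
    have h5 : (j : ℝ) * (C / n) ^ 2 * ∫ x in Ω, f x ≤ C ^ 2 * D / j := by
      calc _ ≤ (j : ℝ) * (C / n) ^ 2 * (D * n) := by gcongr
        _ = C ^ 2 * D / j := by
          rw [hn]; push_cast; field_simp
    calc _ ≤ 0 + ((j : ℝ)⁻¹ * M + C ^ 2 * D / j) / 2 := by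
          refine hmono.trans (add_le_add hle ?_)
          gcongr
      _ = _ := by field_simp; ring
  have hzero : ∀ m, Ψ m =ᵐ[volume.restrict Ω] 0 := fun m => by
    refine (integral_eq_zero_iff_of_nonneg_ae (hΨ0 m) (hΨi m)).1
      (le_antisymm ?_ (integral_nonneg_of_ae (hΨ0 m)))
    refine ge_of_tendsto (tendsto_const_div_atTop_nhds_zero_nat ((M + C ^ 2 * D) / 2)) ?_
    filter_upwards [eventually_ge_atTop 1, eventually_ge_atTop m,
      tendsto_natCast_atTop_atTop.eventually_ge_atTop a] with j h1 h2 h3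
    exact hbound m j h1 h2 h3
  filter_upwards [hmΩ, ae_all_iff.2 hzero] with x hx hx0 has
  obtain ⟨m, hm⟩ := exists_nat_ge (Real.log (-Real.log ‖x‖))
  have h1 := hx0 m
  have h2 : 0 < g (Real.log (-Real.log ‖x‖)) :=
    mul_pos (Real.exp_pos _) (expNegInvGlueDeriv_pos (sub_pos.2 has))
  simp only [hΨ, indicator_of_mem (show Real.log (-Real.log ‖x‖) ∈ Iic (m : ℝ) from hm),
    Pi.zero_apply] at h1
  exact (mul_eq_zero.1 h1).resolve_right
    (mul_pos (inner_pos_of_mem_halfBall hx) (mul_pos (hGpos _ (hr01 x hx)) h2)).ne'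

theorem IsDistributionalSolution.mono {N : ℕ} {Ω : Set (RN N)} {c α β : ℝ} {u : RN N → ℝ}
    (hu : IsDistributionalSolution Ω c α u) (hu0 : ∀ᵐ x ∂(volume.restrict Ω), 0 ≤ u x)
    (hβ : β ≤ α) : IsDistributionalSolution Ω c β u := by
  refine ⟨hu.locallyIntegrableOn, fun φ hφ => le_trans ?_ (hu.inequality φ hφ)⟩
  refine mul_le_mul_of_nonneg_right hβ (integral_nonneg_of_ae ?_)
  filter_upwards [hu0] with x hx
  have := hφ.nonneg x
  simp only [Pi.zero_apply]
  positivity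

theorem mainTheorem3 (N : ℕ) (hN : 1 ≤ N) (ν : RN N) (hν : ‖ν‖ = 1)
    (R : ℝ) (hR0 : 0 < R) (hR1 : R ≤ 1) (α γ : ℝ) (u : RN N → ℝ)
    (hu_nonneg : ∀ᵐ x ∂(volume.restrict (halfBall ν R)), 0 ≤ u x)
    (hu_sol : IsDistributionalSolution (halfBall ν R) ((N : ℝ) ^ 2 / 4) α u)
    (hγ : γ ≤ 1)
    (hu_L2 : MemLp u 2 (weightedMeasure (halfBall ν R) (hardyLerayWeight γ)))
    (hα : 1 / 4 - (1 - γ) ^ 2 ≤ α) :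
    ∀ᵐ x ∂(volume.restrict (halfBall ν R)), u x = 0 := by
  have hu := integrable_sq_mul_hardyLerayWeight hu_L2
  rw [← sub_sub_cancel 1 γ] at hu
  have hT : 0 ≤ -Real.log R := neg_nonneg.2 (Real.log_nonpos hR0.le hR1)
  have hpos : ∀ n : ℕ, 0 < -Real.log R + 1 / ((n : ℝ) + 1) := fun n =>
    add_pos_of_nonneg_of_pos hT Nat.one_div_pos_of_nat
  -- exhaust the half-ball by the sets where `-log |x| > -log R + 1 / (n + 1)`
  have h : ∀ n : ℕ, ∀ᵐ x ∂(volume.restrict (halfBall ν R)),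
      Real.log (-Real.log R + 1 / ((n : ℝ) + 1)) < Real.log (-Real.log ‖x‖) → u x = 0 := by
    refine fun n => ae_eq_zero_of_lt_log hN hν hR1 (sub_nonneg.2 hγ) hu_nonneg
      (hu_sol.mono hu_nonneg hα) hu ?_
    rw [Real.exp_log (hpos n), ← Real.lt_log_iff_exp_lt hR0]
    have : 0 < 1 / ((n : ℝ) + 1) := Nat.one_div_pos_of_nat
    linarith
  filter_upwards [ae_all_iff.2 h, ae_restrict_mem (isOpen_halfBall ν R).measurableSet] with x hx hxΩ
  have hlog : Real.log ‖x‖ < Real.log R :=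
    Real.log_lt_log (norm_pos_of_mem_halfBall hxΩ) (norm_lt_of_mem_halfBall hxΩ)
  obtain ⟨n, hn⟩ := exists_nat_one_div_lt (sub_pos.2 hlog)
  exact hx n (Real.log_lt_log (hpos n) (by linarith))
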